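/- Let $G$ be a finite solvable group. Let $\mathrm{Irr}_m(G)$ be the set of irreducible monomial characters of $G$, that is, the irreducible complex characters of $G$ of the form $\lambda^G$ with $\lambda$ a linear character of some subgroup of $G$, and let $\mathcal{N}_m(G)$ be the set of all $g\in G$ such that $\chi(g)\neq 0$ for every $\chi\in\mathrm{Irr}_m(G)$. Write $\mathbf{F}(H)$ for the Fitting subgroup of a finite group $H$, i.e. the subgroup generated by all nilpotent normal subgroups of $H$. Assume that there exists $x\in\mathcal{N}_m(G)\setminus\mathbf{F}(G)$. Then there exists a normal subgroup $N$ of $G$ with $\mathbf{F}(G)\leq N$ such that, writing $\overline{G}:=G/N$ and $\overline{x}:=xN$, the element $\overline{x}$ is an involution (an element of order exactly $2$) lying in $\mathbf{F}(\overline{G})$, and $\overline{x}\notin\overline{A}$ for every abelian normal subgroup $\overline{A}$ of $\overline{G}$. -/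

import Mathlib

/-- The Fitting subgroup `F(G)`: the subgroup generated by all nilpotent normal subgroups
of `G`. -/
def fittingSubgroup (G : Type*) [Group G] : Subgroup G :=
  sSup {N : Subgroup G | N.Normal ∧ Group.IsNilpotent N}

/-- The set `Irr(G)` of irreducible complex characters of `G`, as functions on `G`. Every
finite-dimensional complex representation has a matrix form, so the spaces `ℂⁿ` suffice. -/
def irrChar (G : Type*) [Group G] : Set (G → ℂ) :=
  {χ | ∃ (n : ℕ) (ρ : Representation ℂ G (Fin n → ℂ)), ρ.IsIrreducible ∧ χ = ρ.character}

open Classical in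
/-- The induced character `lam ^ G` of a linear character `lam` of a subgroup `H` of a finite
group `G`: its value at `g` is `|H|⁻¹ ∑ t, lam (t⁻¹ g t)`, where the sum runs over the `t` in `G`
with `t⁻¹ g t` in `H`. -/
noncomputable def inducedLinearChar {G : Type*} [Group G] [Fintype G] (H : Subgroup G)
    (lam : H →* ℂˣ) (g : G) : ℂ :=
  (Nat.card H : ℂ)⁻¹ * ∑ t : G, if h : t⁻¹ * g * t ∈ H then (lam ⟨t⁻¹ * g * t, h⟩ : ℂ) else 0

/-- The set of irreducible monomial characters of `G`: irreducible characters that are induced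
from a linear character of some subgroup. -/
def irrMonomialChar (G : Type*) [Group G] [Fintype G] : Set (G → ℂ) :=
  {χ | χ ∈ irrChar G ∧ ∃ (H : Subgroup G) (lam : H →* ℂˣ), χ = inducedLinearChar H lam}

/-- The set of monomial-non-vanishing elements of `G`: those at which no irreducible monomial
character vanishes. -/
def monomialNonvanishing (G : Type*) [Group G] [Fintype G] : Set G :=
  {g | ∀ χ ∈ irrMonomialChar G, χ g ≠ 0}

/-! Nonvanishing passes to quotients, since monomial irreducible characters inflate to such
characters. So divide by a normal subgroup maximal subject to `x` staying outside the Fitting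
subgroup; every further nontrivial quotient then takes `x` into its Fitting subgroup. This forces a
unique minimal normal subgroup `W`, elementary abelian of exponent `q`, containing its own
centralizer, complemented (Frattini argument), and with no nontrivial normal `q`-subgroup in the
quotient by `W` (`exists_self_centralizing_split_normal`). The required `N` is the preimage of `W`.

Thanks to the complement, every linear character of `W` extends to its stabilizer, and the extension
induces to an irreducible monomial character, realized on the functions on the orbit. A nonzero
value at `x` gives a point of the orbit fixed by `x`. Hence on the dual of `W`, a faithful module
over the field with `q` elements for the quotient `H` by `W`, `x` fixes a vector in every `H`-orbit.
The `p`-parts of the image of `x` lie in normal `p`-subgroups of `H` with `p ≠ q`, so the action of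
these subgroups is coprime.

The heart is `pow_acts_trivially_of_fixes_point_in_each_orbit`: in this situation the square of such
a `p`-part acts trivially, and so does the `p`-part itself if it lies in a commutative normal
`p`-subgroup. By induction on the dimension one may assume that every nontrivial normal elementary
abelian subgroup of the `p`-group is cyclic and fixes no nonzero vector: otherwise the space splits
into smaller pieces, each stabilized by `x`. Then an element of a commutative normal subgroup that
fixes a nonzero vector is trivial, and it remains to see that the normal closure of `x` (`p` odd) or
of `x ^ 2` (`p = 2`) is commutative. If not, it contains a minimal noncommutative normal subgroup
`E` of class two and small exponent, and one shows that `x`, respectively `x ^ 2`, centralizes `E`.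
Then so does its normal closure, which contains `E`, a contradiction. -/

/-! ### Power identities in class two, and the exponent `p` or `4`. -/

theorem pow_mul_of_commutator_commute {G : Type*} [Group G] {e f z : G} (hzf : Commute z f)
    (h : f * e = e * f * z) (k : ℕ) : f ^ k * e = e * f ^ k * z ^ k := by
  induction k with
  | zero => simp
  | succ k ih =>
    rw [pow_succ, mul_assoc, h, mul_assoc e f z, ← mul_assoc (f ^ k), ih, pow_succ z]
    simp only [mul_assoc]
    rw [← mul_assoc (z ^ k) f, (hzf.pow_left k).eq]
    simp only [mul_assoc]

theorem mul_pow_of_commutator_commute {G : Type*} [Group G] {e f z : G} (hze : Commute z e)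
    (hzf : Commute z f) (h : f * e = e * f * z) (k : ℕ) :
    (e * f) ^ k = e ^ k * f ^ k * z ^ k.choose 2 := by
  induction k with
  | zero => simp
  | succ k ih =>
    rw [pow_succ, ih, Nat.choose_succ_succ' k 1, Nat.choose_one_right, pow_add z, pow_succ e k,
      pow_succ f k]
    have h1 : z ^ k.choose 2 * (e * f) = e * f * z ^ k.choose 2 :=
      ((hze.mul_right hzf).pow_left _).eq
    calc e ^ k * f ^ k * z ^ k.choose 2 * (e * f)
        = e ^ k * (f ^ k * e) * f * z ^ k.choose 2 := by
          rw [mul_assoc _ (z ^ _), h1]; simp only [mul_assoc]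
      _ = e ^ k * e * f ^ k * (z ^ k * f) * z ^ k.choose 2 := by
          rw [pow_mul_of_commutator_commute hzf h]; simp only [mul_assoc]
      _ = _ := by
          rw [(hzf.pow_left k).eq]; simp only [mul_assoc]

/-- The exponent attached to a prime `p`: `p` itself if `p` is odd, and `4` if `p = 2`. -/
def IsClassTwoExponent (p n : ℕ) : Prop :=
  n = p ∧ p ≠ 2 ∨ n = 4 ∧ p = 2

namespace IsClassTwoExponent

variable {p n : ℕ}

theorem dvd (hn : IsClassTwoExponent p n) : p ∣ n := by
  rcases hn with ⟨rfl, -⟩ | ⟨rfl, rfl⟩ <;> norm_num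

theorem exists_eq_pow (hn : IsClassTwoExponent p n) : ∃ b, n = p ^ b := by
  rcases hn with ⟨rfl, -⟩ | ⟨rfl, rfl⟩
  · exact ⟨1, by simp⟩
  · exact ⟨2, by norm_num⟩

theorem dvd_choose (hp : p.Prime) (hn : IsClassTwoExponent p n) : p ∣ n.choose 2 := by
  rcases hn with ⟨rfl, h⟩ | ⟨rfl, rfl⟩
  · exact hp.dvd_choose_self (by norm_num) (lt_of_le_of_ne hp.two_le (Ne.symm h))
  · decide

theorem mul_pow (hp : p.Prime) (hn : IsClassTwoExponent p n) {G : Type*} [Group G] {e f z : G}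
    (hze : Commute z e) (hzf : Commute z f) (h : f * e = e * f * z) (hz : z ^ p = 1) :
    (e * f) ^ n = e ^ n * f ^ n := by
  obtain ⟨m, hm⟩ := hn.dvd_choose hp
  rw [mul_pow_of_commutator_commute hze hzf h, hm, pow_mul, hz, one_pow, mul_one]

/-- Lifting the exponent. For `p = 2` it needs `r ≡ 1` modulo `4`, since then `r + 1` is twice an
odd number; this is one reason for the exponent `4`, the other being that `2` divides `4.choose 2`
but not `2.choose 2`. -/
theorem dvd_mul_sub_one (hp : p.Prime) (hn : IsClassTwoExponent p n) {r : ℤ} {a : ℕ}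
    (hr : (n : ℤ) ∣ r - 1) (h : (p : ℤ) ^ a ∣ r ^ p - 1) : (p : ℤ) ^ a ∣ p * (r - 1) := by
  rcases hn with ⟨rfl, h2⟩ | ⟨rfl, rfl⟩
  · have hp' : ¬ (n : ℤ) ∣ r := by
      intro hd
      have : (n : ℤ) ∣ 1 := by simpa using dvd_sub hd hr
      exact (Nat.prime_iff_prime_int.mp hp).not_isUnit (isUnit_of_dvd_one this)
    have key := Int.emultiplicity_pow_sub_pow hp (hp.odd_of_ne_two h2) (x := r) (y := 1)
      (by simpa using hr) hp' n
    rw [pow_dvd_iff_le_emultiplicity] at h ⊢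
    rw [one_pow] at key
    rw [key] at h
    rw [emultiplicity_mul (Nat.prime_iff_prime_int.mp hp), add_comm]
    have : emultiplicity (n : ℤ) n = emultiplicity n n := by
      exact_mod_cast Int.natCast_emultiplicity n n
    rw [this]; exact h
  · obtain ⟨t, ht⟩ := hr
    have e1 : r ^ 2 - 1 = (2 * t + 1) * (2 * (r - 1)) := by
      have : r = 4 * t + 1 := by push_cast at ht; linarith
      rw [this]; ring
    rw [e1] at h
    refine IsCoprime.dvd_of_dvd_mul_left (IsCoprime.pow_left ?_) h
    exact ⟨-t, 1, by push_cast; ring⟩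

end IsClassTwoExponent

/-! ### Normal cyclic subgroups and minimal noncommutative normal `p`-subgroups. -/

section

variable {H : Type*} [Group H]

theorem zpowers_normal_of_mem {g a : H} (hg : (Subgroup.zpowers g).Normal)
    (ha : a ∈ Subgroup.zpowers g) : (Subgroup.zpowers a).Normal := by
  obtain ⟨k, rfl⟩ := Subgroup.mem_zpowers_iff.mp ha
  refine ⟨fun y hy h => ?_⟩
  obtain ⟨l, rfl⟩ := Subgroup.mem_zpowers_iff.mp hy
  obtain ⟨r, hr⟩ := Subgroup.mem_zpowers_iff.mp (hg.conj_mem g (Subgroup.mem_zpowers g) h)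
  refine Subgroup.mem_zpowers_iff.mpr ⟨r * l, ?_⟩
  rw [← conj_zpow, ← conj_zpow, ← hr, ← zpow_mul, ← zpow_mul, ← zpow_mul]
  congr 1; ring

theorem sup_zpowers_normal {N : Subgroup H} [N.Normal] {e : H}
    (h : ∀ g, g * e * g⁻¹ * e⁻¹ ∈ N) : (N ⊔ Subgroup.zpowers e).Normal := by
  refine ⟨fun d hd g => ?_⟩
  obtain ⟨n, hn, y, hy, rfl⟩ := Subgroup.mem_sup_of_normal_left.mp hd
  obtain ⟨k, rfl⟩ := Subgroup.mem_zpowers_iff.mp hy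
  have h1 : g * (n * e ^ k) * g⁻¹ = g * n * g⁻¹ * (g * e * g⁻¹) ^ k := by
    rw [conj_zpow]; group
  have h2 : g * e * g⁻¹ ∈ N ⊔ Subgroup.zpowers e := by
    have := mul_mem (Subgroup.mem_sup_left (h g))
      (Subgroup.mem_sup_right (Subgroup.mem_zpowers e) : e ∈ N ⊔ Subgroup.zpowers e)
    simpa using this
  rw [h1]
  exact mul_mem (Subgroup.mem_sup_left (Subgroup.Normal.conj_mem ‹_› n hn g)) (zpow_mem h2 k)

/-- Conjugations act on a normal cyclic subgroup by commuting automorphisms. -/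
theorem commutator_commute_of_zpowers_normal {c : H} (hc : (Subgroup.zpowers c).Normal)
    (g e : H) : Commute (g * e * g⁻¹ * e⁻¹) c := by
  obtain ⟨r, hr⟩ := Subgroup.mem_zpowers_iff.mp (hc.conj_mem c (Subgroup.mem_zpowers c) e)
  obtain ⟨t, ht⟩ := Subgroup.mem_zpowers_iff.mp (hc.conj_mem c (Subgroup.mem_zpowers c) g⁻¹)
  rw [inv_inv] at ht
  have key : g * e * g⁻¹ * c * (g * e * g⁻¹)⁻¹ = e * c * e⁻¹ := by
    calc g * e * g⁻¹ * c * (g * e * g⁻¹)⁻¹ = g * (e * (g⁻¹ * c * g) * e⁻¹) * g⁻¹ := by group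
      _ = g * ((c ^ t) ^ r) * g⁻¹ := by
        rw [← ht, ← conj_zpow, ← hr, ← zpow_mul, ← zpow_mul, mul_comm]
      _ = c ^ r := by rw [ht, ← conj_zpow]; group
      _ = _ := hr
  have : (g * e * g⁻¹) * c * (g * e * g⁻¹)⁻¹ * (e * c * e⁻¹)⁻¹ = 1 := by rw [key]; simp
  show g * e * g⁻¹ * e⁻¹ * c = c * (g * e * g⁻¹ * e⁻¹)
  obtain ⟨s, hs⟩ := Subgroup.mem_zpowers_iff.mp (hc.conj_mem c (Subgroup.mem_zpowers c) e⁻¹)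
  rw [inv_inv] at hs
  have h3 : g * e * g⁻¹ * (e⁻¹ * c * e) * (g * e * g⁻¹)⁻¹ = c := by
    rw [← hs, ← conj_zpow, key, conj_zpow, hs]; group
  calc g * e * g⁻¹ * e⁻¹ * c
      = g * e * g⁻¹ * (e⁻¹ * c * e) * (g * e * g⁻¹)⁻¹ * (g * e * g⁻¹ * e⁻¹) := by group
    _ = _ := by rw [h3]

/-- A `p`-element commuting with `e ^ p` up to powers: if `e = c * e ^ (p * j)` with `c` in `C`,
then `e` is in `C`. -/
theorem mem_of_zpow_one_sub_mem {p : ℕ} {e : H} {C : Subgroup H} {k : ℕ}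
    (he : e ^ p ^ k = 1) {j : ℤ} (h : e ^ (1 - p * j) ∈ C) : e ∈ C := by
  have hco : IsCoprime (1 - (p : ℤ) * j) ((p : ℤ) ^ k) :=
    IsCoprime.pow_right ⟨1, j, by ring⟩
  obtain ⟨u, v, huv⟩ := hco
  have : e = (e ^ (1 - (p : ℤ) * j)) ^ u := by
    rw [← zpow_mul]
    have h1 : (1 - (p : ℤ) * j) * u = 1 - (p : ℤ) ^ k * v := by linarith
    have h2 : e ^ ((p : ℤ) ^ k * v) = 1 := by
      rw [zpow_mul]; norm_cast; rw [he, one_zpow]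
    rw [h1, zpow_sub, h2]; simp
  rw [this]; exact zpow_mem h u

theorem mem_zpowers_zpow_of_not_dvd {p : ℕ} (hp : p.Prime) {m : H} {k : ℕ} (hk : m ^ p ^ k = 1)
    {j : ℤ} (hpj : ¬ (p : ℤ) ∣ j) : m ∈ Subgroup.zpowers (m ^ j) := by
  have hco : IsCoprime j ((p : ℤ) ^ k) := by
    refine IsCoprime.pow_right (IsCoprime.symm ?_)
    exact ((Nat.prime_iff_prime_int.mp hp).irreducible.coprime_iff_not_dvd).mpr hpj
  obtain ⟨u, v, huv⟩ := hco
  refine Subgroup.mem_zpowers_iff.mpr ⟨u, ?_⟩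
  have h2 : m ^ ((p : ℤ) ^ k) = 1 := by exact_mod_cast hk
  rw [← zpow_mul, mul_comm, eq_sub_of_add_eq huv, zpow_sub, mul_comm v, zpow_mul, h2]
  simp

theorem exists_pow_not_mem_and_pow_mem {p : ℕ} {N : Subgroup H} {y : H} (hy : y ∉ N) {k : ℕ}
    (hk : y ^ p ^ k ∈ N) : ∃ i, y ^ p ^ i ∉ N ∧ (y ^ p ^ i) ^ p ∈ N := by
  classical
  have hex : ∃ k, y ^ p ^ k ∈ N := ⟨k, hk⟩
  obtain ⟨i, hi⟩ : ∃ i, Nat.find hex = i + 1 := by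
    refine Nat.exists_eq_succ_of_ne_zero fun h0 => hy ?_
    simpa [h0] using Nat.find_spec hex
  refine ⟨i, Nat.find_min hex (by omega), ?_⟩
  rw [← pow_mul, ← pow_succ, ← hi]
  exact Nat.find_spec hex

variable [Finite H]

/-- If `Y` is not central in `E`, its centralizer `C = ⟨c⟩` in `E` is a proper cyclic
self-centralizing subgroup, and `E = C⟨e⟩` with `e ^ p ∈ C`. The commutator of `e` and `c` turns out
to be central of order `p`, so `E` behaves like a modular `p`-group: its elements of exponent `n`
form a commutative normal subgroup which is not cyclic, against `hcyc`. -/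
theorem le_center_of_lt_of_forall_lt_cyclic {p n : ℕ} (hp : p.Prime)
    (hn : IsClassTwoExponent p n) {E Y : Subgroup H} [E.Normal] [Y.Normal] (hE : IsPGroup p E)
    (hmin : ∀ D : Subgroup H, D.Normal → D < E → ∃ c, D = Subgroup.zpowers c)
    (hcyc : ∀ D : Subgroup H, D.Normal → D ≤ E → (∀ a ∈ D, ∀ b ∈ D, Commute a b) →
      ∃ c, D = Subgroup.zpowers c)
    (hcent : ∀ c ∈ E, (Subgroup.zpowers c).Normal → c ^ n = 1 → ∀ y ∈ E, Commute y c)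
    (hY : Y < E) : ∀ y ∈ Y, ∀ e ∈ E, Commute e y := by
  have hexp : ∀ e ∈ E, ∃ k : ℕ, e ^ p ^ k = 1 := by
    intro e he
    obtain ⟨k, hk⟩ := hE ⟨e, he⟩
    exact ⟨k, by simpa [Subtype.ext_iff] using hk⟩
  by_contra hcon
  push Not at hcon
  obtain ⟨y0, hy0, e0, he0, hne0⟩ := hcon
  obtain ⟨y1, hY1⟩ := hmin Y inferInstance hY
  have hYcomm : ∀ a ∈ Y, ∀ b ∈ Y, Commute a b := by
    intro a ha b hb
    rw [hY1] at ha hb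
    obtain ⟨i, rfl⟩ := Subgroup.mem_zpowers_iff.mp ha
    obtain ⟨j, rfl⟩ := Subgroup.mem_zpowers_iff.mp hb
    exact (Commute.refl y1).zpow_zpow i j
  set C : Subgroup H := E ⊓ Subgroup.centralizer (Y : Set H) with hCdef
  have hmemC : ∀ g, g ∈ C ↔ g ∈ E ∧ ∀ y ∈ Y, Commute g y := by
    intro g
    rw [hCdef, Subgroup.mem_inf, Subgroup.mem_centralizer_iff]
    exact and_congr_right fun _ => forall₂_congr fun y _ => eq_comm
  have hCn : C.Normal := inferInstance
  have hCE : C < E := by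
    refine lt_of_le_of_ne inf_le_left fun h => hne0 ?_
    rw [← h] at he0
    exact ((hmemC e0).mp he0).2 y0 hy0
  obtain ⟨c, hc⟩ := hmin C hCn hCE
  have hcn : (Subgroup.zpowers c).Normal := hc ▸ hCn
  have hcC : c ∈ C := hc ▸ Subgroup.mem_zpowers c
  -- `Y` is commutative, so `Y ≤ C`; whatever centralizes `c` therefore centralizes `Y`.
  have hself : ∀ e ∈ E, Commute e c → e ∈ C := by
    intro e he hec
    refine (hmemC e).mpr ⟨he, fun y hy => ?_⟩
    have : y ∈ C := (hmemC y).mpr ⟨hY.le hy, fun y' hy' => hYcomm y hy y' hy'⟩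
    rw [hc] at this
    obtain ⟨i, rfl⟩ := Subgroup.mem_zpowers_iff.mp this
    exact hec.zpow_right i
  -- The join is normal because commutators with `e` centralize `c` and so lie in `C`. Were it
  -- proper it would be cyclic, and `e` would commute with `c`.
  have hgen : ∀ e ∈ E, e ∉ C → C ⊔ Subgroup.zpowers e = E := by
    intro e he heC
    have hDn : (C ⊔ Subgroup.zpowers e).Normal := by
      refine sup_zpowers_normal fun g => hself _ ?_ (commutator_commute_of_zpowers_normal hcn g e)
      exact mul_mem (Subgroup.Normal.conj_mem inferInstance e he g) (inv_mem he)
    have hDE : C ⊔ Subgroup.zpowers e ≤ E := sup_le hCE.le (by simpa using he)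
    by_contra hne
    obtain ⟨d, hd⟩ := hmin _ hDn (lt_of_le_of_ne hDE hne)
    have h1 : e ∈ Subgroup.zpowers d := hd ▸ Subgroup.mem_sup_right (Subgroup.mem_zpowers e)
    have h2 : c ∈ Subgroup.zpowers d := hd ▸ Subgroup.mem_sup_left hcC
    obtain ⟨i, rfl⟩ := Subgroup.mem_zpowers_iff.mp h1
    obtain ⟨j, hj⟩ := Subgroup.mem_zpowers_iff.mp h2
    exact heC (hself _ he (by rw [← hj]; exact (Commute.refl d).zpow_zpow i j))
  obtain ⟨e, he, heC⟩ := SetLike.exists_of_lt hCE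
  have hpC : e ^ p ∈ C := by
    by_contra hep
    have h1 : e ∈ C ⊔ Subgroup.zpowers (e ^ p) := (hgen _ (pow_mem he p) hep) ▸ he
    obtain ⟨c', hc', y, hy, hcy⟩ := Subgroup.mem_sup_of_normal_left.mp h1
    obtain ⟨j, rfl⟩ := Subgroup.mem_zpowers_iff.mp hy
    obtain ⟨k, hk⟩ := hexp e he
    refine heC (mem_of_zpow_one_sub_mem hk (j := j) ?_)
    have : e ^ (1 - (p : ℤ) * j) = c' := by
      rw [zpow_sub, zpow_one, zpow_mul, zpow_natCast]
      exact (eq_mul_inv_of_mul_eq hcy).symm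
    rwa [this]
  obtain ⟨r, hr⟩ := Subgroup.mem_zpowers_iff.mp (hcn.conj_mem c (Subgroup.mem_zpowers c) e)
  have hcpow : ∀ i : ℤ, c ^ i ∈ C := fun i => zpow_mem hcC i
  have hcnorm : ∀ i : ℤ, (Subgroup.zpowers (c ^ i)).Normal := fun i =>
    zpowers_normal_of_mem hcn (Subgroup.zpow_mem_zpowers c i)
  have hord : ¬ orderOf c ∣ n := by
    intro h
    exact heC (hself e he (hcent c (hCE.le hcC) hcn (orderOf_dvd_iff_pow_eq_one.mp h) e he))
  obtain ⟨k, hk⟩ := hexp c (hCE.le hcC)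
  obtain ⟨a, -, ha⟩ := (Nat.dvd_prime_pow hp).mp (orderOf_dvd_of_pow_eq_one hk)
  obtain ⟨b, hb⟩ := hn.exists_eq_pow
  have hba : n ∣ orderOf c := by
    rw [ha, hb] at hord ⊢
    refine pow_dvd_pow p ?_
    by_contra hlt
    exact hord (pow_dvd_pow p (by omega))
  obtain ⟨m, hm⟩ := hba
  have hmpos : 0 < m := by
    rcases Nat.eq_zero_or_pos m with h | h
    · rw [h, mul_zero] at hm; exact absurd hm (orderOf_pos c).ne'
    · exact h
  set z := c ^ (r - 1) with hz
  have hecz : e * c = z * c * e := by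
    rw [hz, ← zpow_add_one, sub_add_cancel, hr]; group
  have hzp : z ^ p = 1 := by
    -- `c ^ m` has exponent `n`, so it is central in `E` by `hcent`; this says that `e` acts on `c`
    -- by an exponent congruent to `1` modulo `n`.
    have h1 : (n : ℤ) ∣ r - 1 := by
      have h2 : (c ^ (m : ℤ)) ^ n = 1 := by
        rw [← zpow_natCast, ← zpow_mul, mul_comm, ← Nat.cast_mul, ← hm, zpow_natCast,
          pow_orderOf_eq_one]
      have h3 := hcent _ (hCE.le (hcpow m)) (hcnorm m) h2 e he
      have h4 : c ^ (r * m) = c ^ (m : ℤ) := by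
        rw [zpow_mul, hr, conj_zpow]
        exact mul_inv_eq_of_eq_mul h3.eq
      have h5 : c ^ ((r - 1) * m) = 1 := by
        rw [sub_mul, one_mul, zpow_sub, h4, mul_inv_cancel]
      have h6 := orderOf_dvd_iff_zpow_eq_one.mpr h5
      rw [hm, Nat.cast_mul] at h6
      exact Int.dvd_of_mul_dvd_mul_right (by exact_mod_cast hmpos.ne') h6
    have h2 : (p : ℤ) ^ a ∣ r ^ p - 1 := by
      have h3 : ∀ q : ℕ, e ^ q * c * (e ^ q)⁻¹ = c ^ (r ^ q) := by
        intro q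
        induction q with
        | zero => simp
        | succ q ih =>
          calc e ^ (q + 1) * c * (e ^ (q + 1))⁻¹ = e * (e ^ q * c * (e ^ q)⁻¹) * e⁻¹ := by
                rw [pow_succ']; group
            _ = _ := by rw [ih, ← conj_zpow, ← hr, ← zpow_mul, pow_succ']
      have h4 : Commute (e ^ p) c := by
        rw [hc] at hpC
        obtain ⟨i, hi⟩ := Subgroup.mem_zpowers_iff.mp hpC
        rw [← hi]; exact (Commute.refl c).zpow_left i
      have h5 : c ^ (r ^ p - 1) = 1 := by
        rw [zpow_sub, ← h3 p, h4.eq]; group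
      have h6 := orderOf_dvd_iff_zpow_eq_one.mpr h5
      rw [ha] at h6
      exact_mod_cast h6
    have h3 := hn.dvd_mul_sub_one hp h1 h2
    rw [hz, ← zpow_natCast, ← zpow_mul, ← orderOf_dvd_iff_zpow_eq_one, ha, mul_comm]
    exact_mod_cast h3
  have hzC : z ∈ C := hcpow _
  have hzcent : ∀ y ∈ E, Commute y z := by
    obtain ⟨q, hq⟩ := hn.dvd
    exact hcent z (hCE.le hzC) (hcnorm _) (by rw [hq, pow_mul, hzp, one_pow])
  have hzord : orderOf z = p := by
    refine orderOf_eq_prime_iff (hp := ⟨hp⟩) |>.mpr ⟨hzp, fun h => heC (hself e he ?_)⟩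
    rw [h, one_mul] at hecz
    exact hecz
  -- replace `e` by an element `f` with `f ^ n = 1`
  have hecw : ∀ i : ℤ, e * c ^ i = z ^ i * c ^ i * e := by
    intro i
    have h1 : e * c ^ i * e⁻¹ = (z * c) ^ i := by
      rw [← conj_zpow, hecz]; group
    rw [(hzcent c (hCE.le hcC)).symm.mul_zpow] at h1
    rw [← h1]; group
  obtain ⟨j, hj⟩ := Subgroup.mem_zpowers_iff.mp (show e ^ p ∈ Subgroup.zpowers c from hc ▸ hpC)
  -- `e` commutes with `e ^ p = c ^ j`, which forces `z ^ j = 1`. So `e ^ p` is the `p`-th power of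
  -- an element `w` of `C`, and dividing `e` by `w` kills its `n`-th power.
  obtain ⟨j', rfl⟩ : (p : ℤ) ∣ j := by
    rw [← hzord, orderOf_dvd_iff_zpow_eq_one]
    have h1 := hecw j
    rw [hj, (Commute.refl e).pow_right p |>.eq, mul_assoc] at h1
    exact mul_eq_right.mp h1.symm
  set w := c ^ j' with hw
  have hwp : e ^ p = w ^ p := by rw [← hj, hw, mul_comm, zpow_mul, zpow_natCast]
  have hwC : w ∈ C := hcpow _
  set f := e * w⁻¹ with hf
  have hfE : f ∈ E := mul_mem he (inv_mem (hCE.le hwC))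
  have hfC : f ∉ C := fun h => heC (by simpa [hf] using mul_mem h hwC)
  have hfn : f ^ n = 1 := by
    rw [hf, hn.mul_pow hp (z := z ^ j') ((hzcent e he).symm.zpow_left _)
      (((hzcent w (hCE.le hwC)).symm.zpow_left _).inv_right) ?_ ?_]
    · obtain ⟨q, hq⟩ := hn.dvd
      rw [hq, pow_mul, pow_mul, hwp, inv_pow, inv_pow, mul_inv_cancel]
    · have h1 := hecw j'
      rw [← hw] at h1
      rw [inv_mul_eq_iff_eq_mul]
      have h2 : Commute (z ^ j') w := (hzcent w (hCE.le hwC)).symm.zpow_left _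
      have h3 : Commute (z ^ j') e := (hzcent e he).symm.zpow_left _
      calc e = w * (w⁻¹ * (e * w) * w⁻¹) := by group
        _ = w * (w⁻¹ * (z ^ j' * w * e) * w⁻¹) := by rw [h1]
        _ = z ^ j' * (w * e * w⁻¹) := by rw [h2.eq]; simp only [mul_assoc]; rw [inv_mul_cancel_left, ← mul_assoc w, ← mul_assoc, ← h2.eq]; group
        _ = _ := by
          rw [((h2.mul_right h3).mul_right h2.inv_right).eq]; group
    · rw [← zpow_natCast, ← zpow_mul, mul_comm, zpow_mul, zpow_natCast, hzp, one_zpow]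
  have hfcw : ∀ i : ℤ, f * c ^ i = z ^ i * c ^ i * f := by
    intro i
    have h1 : Commute w⁻¹ (c ^ i) := ((Commute.refl c).zpow_zpow j' i).inv_left
    rw [hf, mul_assoc, h1.eq, ← mul_assoc, hecw, mul_assoc]
  have hfkcw : ∀ k i : ℤ, f ^ k * c ^ i = c ^ i * f ^ k * (z ^ i) ^ k := by
    intro k i
    have h0 : Commute (z ^ i) f := (hzcent f hfE).symm.zpow_left i
    have h1 : (c ^ i)⁻¹ * f * c ^ i = f * z ^ i := by
      rw [mul_assoc, hfcw]
      have h2 : Commute (z ^ i) (c ^ i) := ((hzcent c (hCE.le hcC)).symm.zpow_zpow i i)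
      rw [h2.eq, ← h0.eq]; group
    have h3 : (c ^ i)⁻¹ * f ^ k * c ^ i = f ^ k * (z ^ i) ^ k := by
      rw [← h0.symm.mul_zpow, ← h1]
      have := conj_zpow (i := k) (a := (c ^ i)⁻¹) (b := f)
      rw [inv_inv] at this
      exact this.symm
    rw [mul_assoc, ← h3]; group
  -- The `n`-th power is multiplicative on products `c ^ i * f ^ k` and kills `f`, so it must kill
  -- `c ^ i`, which is then central by `hcent`. Any two elements of exponent `n` therefore commute.
  have hdecomp : ∀ y ∈ E, y ^ n = 1 → ∃ i k : ℤ, y = c ^ i * f ^ k ∧ (c ^ i) ^ n = 1 := by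
    intro y hy hyn
    rw [← hgen f hfE hfC] at hy
    obtain ⟨c', hc', y', hy', rfl⟩ := Subgroup.mem_sup_of_normal_left.mp hy
    rw [hc] at hc'
    obtain ⟨i, rfl⟩ := Subgroup.mem_zpowers_iff.mp hc'
    obtain ⟨k, rfl⟩ := Subgroup.mem_zpowers_iff.mp hy'
    refine ⟨i, k, rfl, ?_⟩
    rw [hn.mul_pow hp (z := (z ^ i) ^ k)
      ((((hzcent c (hCE.le hcC)).symm.zpow_left i).zpow_left k).zpow_right i)
      ((((hzcent f hfE).symm.zpow_left i).zpow_left k).zpow_right k) (hfkcw k i) ?_] at hyn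
    · have : (f ^ k) ^ n = 1 := by
        rw [← zpow_natCast, ← zpow_mul, mul_comm, zpow_mul, zpow_natCast, hfn, one_zpow]
      rwa [this, mul_one] at hyn
    · rw [← zpow_mul, ← zpow_natCast, ← zpow_mul, mul_comm, zpow_mul, zpow_natCast, hzp,
        one_zpow]
  have hcomm : ∀ y ∈ E, y ^ n = 1 → ∀ y' ∈ E, y' ^ n = 1 → Commute y y' := by
    intro y hy hyn y' hy' hyn'
    obtain ⟨i, k, hyeq, hi⟩ := hdecomp y hy hyn
    obtain ⟨i', k', hyeq', hi'⟩ := hdecomp y' hy' hyn'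
    have h1 := hcent _ (hCE.le (hcpow i)) (hcnorm i) hi
    have h2 := hcent _ (hCE.le (hcpow i')) (hcnorm i') hi'
    rw [hyeq']
    refine Commute.mul_right (h2 y hy) ?_
    rw [hyeq]
    exact Commute.mul_left (h1 _ (zpow_mem hfE k')).symm ((Commute.refl f).zpow_zpow k k')
  let D : Subgroup H :=
    { carrier := {y | y ∈ E ∧ y ^ n = 1}
      mul_mem' := fun {x y} hx hy => ⟨mul_mem hx.1 hy.1, by
        rw [(hcomm x hx.1 hx.2 y hy.1 hy.2).mul_pow, hx.2, hy.2, one_mul]⟩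
      one_mem' := ⟨one_mem _, one_pow _⟩
      inv_mem' := fun {x} hx => ⟨inv_mem hx.1, by rw [inv_pow, hx.2, inv_one]⟩ }
  have hDn : D.Normal := ⟨fun y hy g => ⟨Subgroup.Normal.conj_mem inferInstance y hy.1 g, by
    rw [conj_pow, hy.2]; group⟩⟩
  obtain ⟨d, hd⟩ := hcyc D hDn (fun y hy => hy.1)
    fun y hy y' hy' => hcomm y hy.1 hy.2 y' hy'.1 hy'.2
  have hdD : d ∈ D := hd ▸ Subgroup.mem_zpowers d
  have hc0 : orderOf (c ^ m) = n := by
    rw [orderOf_pow_of_dvd hmpos.ne' ⟨n, by rw [hm, mul_comm]⟩, hm, Nat.mul_div_cancel _ hmpos]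
  have hc0D : c ^ m ∈ D := ⟨hCE.le (pow_mem hcC m), by rw [← hc0, pow_orderOf_eq_one]⟩
  have hle : Subgroup.zpowers (c ^ m) ≤ Subgroup.zpowers d := by
    rw [← hd]; simpa using hc0D
  -- `d` has order at most `n`, while `c ^ m` already has order `n`. Hence `f`, an element of `D`,
  -- falls into `C`.
  have heq : Subgroup.zpowers (c ^ m) = Subgroup.zpowers d := by
    refine Subgroup.eq_of_le_of_card_ge hle ?_
    rw [Nat.card_zpowers, Nat.card_zpowers, hc0]
    have hn0 : 0 < n := by
      rcases Nat.eq_zero_or_pos n with h | h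
      · rw [h, zero_mul] at hm; exact absurd hm (orderOf_pos c).ne'
      · exact h
    exact Nat.le_of_dvd hn0 (orderOf_dvd_of_pow_eq_one hdD.2)
  have hfD : f ∈ Subgroup.zpowers (c ^ m) := by
    rw [heq, ← hd]; exact ⟨hfE, hfn⟩
  exact hfC (Subgroup.zpowers_le.mpr (pow_mem hcC m) hfD)

end

/-- A normal subgroup of a group contained in a nilpotent subgroup `P` and equal to its commutator
with `P` is trivial. -/
theorem eq_bot_of_le_commutator {H : Type*} [Group H] {E P : Subgroup H} (hP : Group.IsNilpotent P)
    (hEP : E ≤ P) (h : E ≤ ⁅E, P⁆) : E = ⊥ := by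
  obtain ⟨k, hk⟩ := (Subgroup.isNilpotent_iff_lowerCentralSeries P).mp hP
  have : ∀ j, E ≤ P.lowerCentralSeries j := by
    intro j
    induction j with
    | zero => exact hEP
    | succ j ih =>
      rw [Subgroup.lowerCentralSeries_succ]
      exact h.trans (Subgroup.commutator_mono ih le_rfl)
  rw [eq_bot_iff, ← hk]
  exact this k

/-- Take `E` minimal among the noncommutative normal subgroups inside `Q`. Every proper normal
subgroup of `E` is then central in `E`, so a normal subgroup of `E` defined by a condition is all of
`E` once it contains a noncentral element. The bound on the exponent feeds the final contradiction
for both odd and even `p`. -/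
theorem exists_minimal_noncommutative {H : Type*} [Group H] [Finite H] {p n : ℕ} (hp : p.Prime)
    (hn : IsClassTwoExponent p n) {P Q : Subgroup H} [P.Normal] [Q.Normal] (hP : IsPGroup p P)
    (hQP : Q ≤ P)
    (hcyc : ∀ D : Subgroup H, D.Normal → D ≤ P → (∀ a ∈ D, ∀ b ∈ D, Commute a b) →
      ∃ c, D = Subgroup.zpowers c)
    (hcent : ∀ c ∈ Q, (Subgroup.zpowers c).Normal → c ^ n = 1 → ∀ y ∈ Q, Commute y c)
    (hQ : ¬ ∀ a ∈ Q, ∀ b ∈ Q, Commute a b) :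
    ∃ E : Subgroup H, E.Normal ∧ E ≤ Q ∧ (¬ ∀ a ∈ E, ∀ b ∈ E, Commute a b) ∧
      ∃ m, (Subgroup.zpowers m).Normal ∧
        (∀ a, a ∈ Subgroup.zpowers m ↔ a ∈ E ∧ ∀ e ∈ E, Commute e a) ∧
        (∀ e ∈ E, ∀ y ∈ P, y * e * y⁻¹ * e⁻¹ ∈ Subgroup.zpowers m) ∧
        (∀ e ∈ E, e ^ p ∈ Subgroup.zpowers m) ∧ ∀ e ∈ E, e ^ n = 1 := by
  obtain ⟨E, hEmin⟩ := (Set.toFinite {E : Subgroup H | E.Normal ∧ E ≤ Q ∧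
    ¬ ∀ a ∈ E, ∀ b ∈ E, Commute a b}).exists_minimal ⟨Q, ‹_›, le_rfl, hQ⟩
  obtain ⟨hEn, hEQ, hE⟩ := hEmin.prop
  have hEP := hEQ.trans hQP
  have hmin : ∀ D : Subgroup H, D.Normal → D < E → ∃ c, D = Subgroup.zpowers c := by
    intro D hD hDE
    refine hcyc D hD (hDE.le.trans hEP) ?_
    by_contra hDc
    exact hEmin.not_lt ⟨hD, hDE.le.trans hEQ, hDc⟩ hDE
  have hEp : IsPGroup p E := hP.to_le hEP
  have hexp : ∀ e ∈ E, ∃ k : ℕ, e ^ p ^ k = 1 := by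
    intro e he
    obtain ⟨k, hk⟩ := hEp ⟨e, he⟩
    exact ⟨k, by simpa [Subtype.ext_iff] using hk⟩
  set M : Subgroup H := E ⊓ Subgroup.centralizer (E : Set H) with hMdef
  have hmemM : ∀ g, g ∈ M ↔ g ∈ E ∧ ∀ e ∈ E, Commute e g := by
    intro g
    rw [hMdef, Subgroup.mem_inf, Subgroup.mem_centralizer_iff]
    exact Iff.rfl
  have hMn : M.Normal := inferInstance
  have hME : M < E := by
    refine lt_of_le_of_ne inf_le_left fun h => hE fun a ha b hb => ?_
    rw [← h] at hb
    exact ((hmemM b).mp hb).2 a ha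
  have hleM : ∀ Y : Subgroup H, Y.Normal → Y < E → Y ≤ M := by
    intro Y hYn hY y hy
    exact (hmemM y).mpr ⟨hY.le hy, le_center_of_lt_of_forall_lt_cyclic hp hn hEp hmin
      (fun D hD hDE => hcyc D hD (hDE.trans hEP))
      (fun c hc hcn h y hy => hcent c (hEQ hc) hcn h y (hEQ hy)) hY y hy⟩
  obtain ⟨m, hm⟩ := hmin M hMn hME
  have hcomm : ∀ e ∈ E, ∀ y ∈ P, y * e * y⁻¹ * e⁻¹ ∈ M := by
    have hlt : ⁅E, P⁆ < E := by
      refine lt_of_le_not_ge (Subgroup.commutator_le_left _ _) fun h => ?_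
      have : Fact p.Prime := ⟨hp⟩
      have hbot := eq_bot_of_le_commutator hP.isNilpotent hEP h
      refine hE fun a ha b _ => ?_
      rw [hbot, Subgroup.mem_bot] at ha
      rw [ha]; exact Commute.one_left b
    intro e he y hy
    have h1 := hleM _ inferInstance hlt (Subgroup.commutator_mem_commutator he hy)
    rw [commutatorElement_def] at h1
    simpa [mul_assoc] using inv_mem h1
  have hz : ∀ e ∈ E, ∀ f ∈ E, ∃ z ∈ M, f * e = e * f * z := by
    intro e he f hf
    refine ⟨f⁻¹ * e⁻¹ * f * e, ?_, by group⟩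
    have := hcomm e⁻¹ (inv_mem he) f⁻¹ (inv_mem (hEP hf))
    simpa using this
  have hpM : ∀ e ∈ E, e ^ p ∈ M := by
    -- If `K` were proper it would be central. But among the iterated `p`-th powers of a noncentral
    -- element, the last one outside `M` lies in `K`.
    let K : Subgroup H :=
      { carrier := {e | e ∈ E ∧ e ^ p ∈ M}
        mul_mem' := fun {e f} he hf => by
          refine ⟨mul_mem he.1 hf.1, ?_⟩
          obtain ⟨z, hzM, hzef⟩ := hz e he.1 f hf.1
          rw [mul_pow_of_commutator_commute (((hmemM z).mp hzM).2 e he.1).symm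
            (((hmemM z).mp hzM).2 f hf.1).symm hzef]
          exact mul_mem (mul_mem he.2 hf.2) (pow_mem hzM _)
        one_mem' := ⟨one_mem _, by rw [one_pow]; exact one_mem _⟩
        inv_mem' := fun {e} he => ⟨inv_mem he.1, by rw [inv_pow]; exact inv_mem he.2⟩ }
    have hKn : K.Normal := ⟨fun e he g => ⟨hEn.conj_mem e he.1 g, by
      rw [conj_pow]; exact hMn.conj_mem _ he.2 g⟩⟩
    have hKE : K ≤ E := fun e he => he.1
    have hK : K = E := by
      by_contra hne
      have hKM := hleM K hKn (lt_of_le_of_ne hKE hne)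
      obtain ⟨e, he, heM⟩ := SetLike.exists_of_lt hME
      obtain ⟨k, hk⟩ := hexp e he
      obtain ⟨i, hi1, hi2⟩ := exists_pow_not_mem_and_pow_mem heM (p := p) (k := k)
        (by rw [hk]; exact one_mem _)
      exact hi1 (hKM ⟨pow_mem he _, hi2⟩)
    intro e he
    rw [← hK] at he
    exact he.2
  have hmulpow : ∀ e ∈ E, ∀ f ∈ E, (e * f) ^ n = e ^ n * f ^ n := by
    intro e he f hf
    obtain ⟨z, hzM, hzef⟩ := hz e he f hf
    have h1 := (((hmemM z).mp hzM).2 e he).symm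
    have h2 := (((hmemM z).mp hzM).2 f hf).symm
    refine hn.mul_pow hp h1 h2 hzef ?_
    have h3 := pow_mul_of_commutator_commute h2 hzef p
    rw [← ((hmemM _).mp (hpM f hf)).2 e he] at h3
    exact left_eq_mul.mp h3
  obtain ⟨q, hq⟩ := hn.dvd
  refine ⟨E, hEn, hEQ, hE, m, hm ▸ hMn, fun a => hm ▸ hmemM a, hm ▸ hcomm, hm ▸ hpM, ?_⟩
  let W : Subgroup H :=
    { carrier := {e | e ∈ E ∧ e ^ n = 1}
      mul_mem' := fun {e f} he hf => ⟨mul_mem he.1 hf.1, by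
        rw [hmulpow e he.1 f hf.1, he.2, hf.2, one_mul]⟩
      one_mem' := ⟨one_mem _, one_pow _⟩
      inv_mem' := fun {e} he => ⟨inv_mem he.1, by rw [inv_pow, he.2, inv_one]⟩ }
  have hWn : W.Normal := ⟨fun e he g => ⟨hEn.conj_mem e he.1 g, by
    rw [conj_pow, he.2]; group⟩⟩
  have hWE : W = E := by
    by_contra hne
    have hWM := hleM W hWn (lt_of_le_of_ne (fun e he => he.1) hne)
    obtain ⟨e, he, heM⟩ := SetLike.exists_of_lt hME
    -- If `e ^ p` were a `p`-th power in `M`, then `e` could be corrected by an element of `M` to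
    -- lie in `W ≤ M`. So `e ^ p` generates `M`; correcting any `f` by a power of `e` then puts it
    -- into `M`, and `E = M⟨e⟩` is commutative.
    have hgen : m ∈ Subgroup.zpowers (e ^ p) := by
      obtain ⟨j, hj⟩ := Subgroup.mem_zpowers_iff.mp (show e ^ p ∈ Subgroup.zpowers m from
        hm ▸ hpM e he)
      have hmE : m ∈ E := hME.le (hm ▸ Subgroup.mem_zpowers m)
      by_cases hpj : (p : ℤ) ∣ j
      · obtain ⟨j', rfl⟩ := hpj
        refine absurd ?_ heM
        have hwM : (m ^ j') ∈ M := by rw [hm]; exact Subgroup.zpow_mem_zpowers m j'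
        have h1 : e * (m ^ j')⁻¹ ∈ W := by
          refine ⟨mul_mem he (inv_mem (hME.le hwM)), ?_⟩
          rw [hmulpow e he _ (inv_mem (hME.le hwM)), hq, pow_mul, pow_mul, ← hj, inv_pow,
            ← zpow_natCast (m ^ j'), ← zpow_mul, mul_comm j', inv_pow, mul_inv_cancel]
        simpa using mul_mem (hWM h1) hwM
      · obtain ⟨k, hk⟩ := hexp m hmE
        rw [← hj]
        exact mem_zpowers_zpow_of_not_dvd hp hk hpj
    have hall : ∀ f ∈ E, ∃ i : ℤ, f * (e ^ i)⁻¹ ∈ M := by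
      intro f hf
      have h1 : f ^ p ∈ Subgroup.zpowers (e ^ p) := by
        have h2 : f ^ p ∈ Subgroup.zpowers m := hm ▸ hpM f hf
        exact (Subgroup.zpowers_le.mpr hgen) h2
      obtain ⟨i, hi⟩ := Subgroup.mem_zpowers_iff.mp h1
      have hei : (e ^ i)⁻¹ ∈ E := inv_mem (zpow_mem he i)
      refine ⟨i, hWM ⟨mul_mem hf hei, ?_⟩⟩
      rw [hmulpow f hf _ hei, hq, pow_mul, pow_mul, ← hi, inv_pow, ← zpow_natCast (e ^ i),
        ← zpow_mul, mul_comm i, zpow_mul, zpow_natCast, inv_pow, mul_inv_cancel]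
    refine hE fun f hf g hg => ?_
    obtain ⟨i, hi⟩ := hall f hf
    obtain ⟨j, hj⟩ := hall g hg
    have hc1 : Commute e f := by
      have := (((hmemM _).mp hi).2 e he).mul_right ((Commute.refl e).zpow_right i)
      simpa using this
    have := (((hmemM _).mp hj).2 f hf).mul_right (hc1.symm.zpow_right j)
    simpa using this
  intro e he
  rw [← hWE] at he
  exact he.2

/-! ### A permutation criterion for acting trivially. -/

open Pointwise in
/-- If an element `x` of a nilpotent normal subgroup stabilizes a translate of every subset, then
it acts trivially. -/
theorem smul_eq_self_of_forall_set {H I : Type*} [Group H] [MulAction H I] {P : Subgroup H}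
    [P.Normal] (hP : Group.IsNilpotent P) {x : H} (hx : x ∈ P)
    (h : ∀ S : Set I, ∃ g : H, ∀ i ∈ S, ∃ j ∈ S, x • g • i = g • j) (i : I) : x • i = i := by
  obtain ⟨n, hn⟩ := (Subgroup.isNilpotent_iff_lowerCentralSeries P).mp hP
  -- Descend the lower central series: `x` preserves every orbit of its `k`-th term, and that term
  -- is eventually trivial.
  suffices H : ∀ k, ∀ i : I, ∃ g ∈ P.lowerCentralSeries k, x • i = g • i by
    obtain ⟨g, hg, hgi⟩ := H n i
    rw [hn, Subgroup.mem_bot] at hg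
    rw [hgi, hg, one_smul]
  intro k
  induction k with
  | zero => exact fun i => ⟨x, hx, rfl⟩
  | succ k ih =>
    have hcl : ∀ f ∈ P.lowerCentralSeries k, ∀ y ∈ P, f * y * f⁻¹ * y⁻¹ ∈
        P.lowerCentralSeries (k + 1) := by
      intro f hf y hy
      rw [Subgroup.lowerCentralSeries_succ]
      exact Subgroup.commutator_mem_commutator hf hy
    set L := P.lowerCentralSeries k with hL
    set L' := P.lowerCentralSeries (k + 1) with hL'
    have hLn : L.Normal := inferInstance
    have hL'n : L'.Normal := inferInstance
    have hL'L : L' ≤ L := P.lowerCentralSeries_antitone (Nat.le_succ k)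
    obtain ⟨r, hr, hrr⟩ : ∃ r : I → I, (∀ i, ∃ f ∈ L, r i = f • i) ∧
        ∀ i j, (∃ f ∈ L, i = f • j) → r i = r j := by
      refine ⟨fun i => (Quotient.mk (MulAction.orbitRel L I) i).out, fun i => ?_, ?_⟩
      · have h1 : (MulAction.orbitRel L I) (Quotient.mk (MulAction.orbitRel L I) i).out i :=
          Quotient.mk_out (s := MulAction.orbitRel L I) i
        rw [MulAction.orbitRel_apply] at h1
        obtain ⟨f, hf⟩ := h1
        exact ⟨f, f.2, hf.symm⟩
      · rintro i j ⟨f, hf, rfl⟩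
        have : Quotient.mk (MulAction.orbitRel L I) (f • j) =
            Quotient.mk (MulAction.orbitRel L I) j := by
          refine Quotient.sound (s := MulAction.orbitRel L I) ?_
          exact ⟨⟨f, hf⟩, rfl⟩
        simp only [this]
    intro i
    -- The test set meets each `L`-orbit in exactly one `L'`-orbit, and so does its translate by
    -- `g`. As `x` preserves `L`-orbits, it preserves the chosen `L'`-orbit in each of them; since
    -- `x` commutes with `L` modulo `L'`, it then preserves all the other `L'`-orbits too.
    obtain ⟨g, hg⟩ := h {j | ∃ i, ∃ f ∈ L', j = f • r i}
    obtain ⟨f, hf, hfi⟩ := hr (g⁻¹ • i)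
    obtain ⟨j, ⟨i'', f'', hf'', rfl⟩, hj⟩ := hg (r (g⁻¹ • i)) ⟨g⁻¹ • i, 1, one_mem _, by simp⟩
    -- the translate of the representative, and its image under `x`
    have hgr : g • r (g⁻¹ • i) = (g * f * g⁻¹) • i := by rw [hfi]; simp [mul_smul]
    have hsame : r i'' = r (g⁻¹ • i) := by
      obtain ⟨f1, hf1, h1⟩ := hr i''
      obtain ⟨y, hy, hy1⟩ := ih (g • r (g⁻¹ • i))
      rw [← show r (r i'') = r i'' from hrr _ _ (hr i''),
        ← show r (r (g⁻¹ • i)) = r (g⁻¹ • i) from hrr _ _ (hr _)]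
      refine hrr _ _ ⟨f''⁻¹ * (g⁻¹ * y * g), ?_, ?_⟩
      · refine mul_mem (inv_mem (hL'L hf'')) ?_
        simpa using hLn.conj_mem y hy g⁻¹
      · rw [hy1] at hj
        rw [mul_smul, mul_smul, mul_smul, hj, inv_smul_smul, inv_smul_smul]
    rw [hsame] at hj
    have hF : g * f * g⁻¹ ∈ L := hLn.conj_mem f hf g
    set F := g * f * g⁻¹
    have hG : g * f'' * g⁻¹ ∈ L' := hL'n.conj_mem f'' hf'' g
    have hxj : x • F • i = (g * f'' * g⁻¹) • F • i := by
      rw [← hgr, hj]; simp [mul_smul]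
    refine ⟨F⁻¹ * ((F * x * F⁻¹ * x⁻¹) * (g * f'' * g⁻¹)) * F, ?_, ?_⟩
    · simpa using hL'n.conj_mem _ (mul_mem (hcl F hF x hx) hG) F⁻¹
    · calc x • i = (F⁻¹ * (F * x * F⁻¹ * x⁻¹)) • x • F • i := by
            simp only [← mul_smul]; congr 1; group
        _ = _ := by rw [hxj]; simp only [← mul_smul]; congr 1; group

/-! ### Coprime decomposition into fixed spaces of maximal subgroups. -/

section Representation

variable {k H V : Type*} [Field k] [Group H] [AddCommGroup V] [Module k V]

/-- The vectors fixed by a subgroup. -/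
def fixedVectors (ρ : Representation k H V) (B : Subgroup H) : Submodule k V where
  carrier := {v | ∀ b ∈ B, ρ b v = v}
  add_mem' := fun {v w} hv hw b hb => by rw [map_add, hv b hb, hw b hb]
  zero_mem' := fun b _ => map_zero _
  smul_mem' := fun c v hv b hb => by rw [map_smul, hv b hb]

theorem map_mem_fixedVectors_map_conj {ρ : Representation k H V} {B : Subgroup H} {v : V}
    (hv : v ∈ fixedVectors ρ B) (h : H) :
    ρ h v ∈ fixedVectors ρ (B.map (MulAut.conj h).toMonoidHom) := by
  rintro _ ⟨b, hb, rfl⟩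
  have : (MulAut.conj h).toMonoidHom b * h = h * b := by simp [MulAut.conj_apply]
  rw [← Module.End.mul_apply, ← map_mul, this, map_mul, Module.End.mul_apply, hv b hb]

/-- The stabilizer of a vector. -/
def vectorStabilizer (ρ : Representation k H V) (v : V) : Subgroup H where
  carrier := {h | ρ h v = v}
  mul_mem' := fun {a b} ha hb => by
    show ρ (a * b) v = v
    rw [map_mul, Module.End.mul_apply, hb, ha]
  one_mem' := by show ρ 1 v = v; simp
  inv_mem' := fun {a} ha => by
    show ρ a⁻¹ v = v
    have := Representation.inv_self_apply ρ a v
    rwa [show ρ a v = v from ha] at this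

theorem mem_fixedVectors_iff_le_vectorStabilizer {ρ : Representation k H V} {B : Subgroup H}
    {v : V} : v ∈ fixedVectors ρ B ↔ B ≤ vectorStabilizer ρ v :=
  Iff.rfl

theorem mem_fixedVectors_sup {ρ : Representation k H V} {B C : Subgroup H} {v : V}
    (hB : v ∈ fixedVectors ρ B) (hC : v ∈ fixedVectors ρ C) : v ∈ fixedVectors ρ (B ⊔ C) :=
  mem_fixedVectors_iff_le_vectorStabilizer.mpr (sup_le hB hC)

theorem mem_fixedVectors_zpowers {ρ : Representation k H V} {a : H} {v : V} (h : ρ a v = v) :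
    v ∈ fixedVectors ρ (Subgroup.zpowers a) :=
  mem_fixedVectors_iff_le_vectorStabilizer.mpr (Subgroup.zpowers_le.mpr h)

/-- By Maschke's theorem `V` is a sum of simple modules, each a quotient of the commutative group
algebra by a maximal ideal. There `A` acts through `p`-th roots of unity in a domain, a cyclic group
of order `1` or `p`; the order is not `1` because `A` fixes no nonzero vector, so the kernel is a
maximal subgroup. -/
theorem mem_iSup_fixedVectors_of_isCoatom {A : Type*} [CommGroup A] [Finite A] {p : ℕ}
    (hp : p.Prime) (hexp : ∀ a : A, a ^ p = 1) (hk : (Nat.card A : k) ≠ 0)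
    (ρ : Representation k A V) (hfix : fixedVectors ρ ⊤ = ⊥) (v : V) :
    v ∈ ⨆ (B : Subgroup A) (_ : IsCoatom B), fixedVectors ρ B := by
  have : NeZero (Nat.card A : k) := ⟨hk⟩
  have htop := IsSemisimpleModule.sSup_simples_eq_top (MonoidAlgebra k A) ρ.asModule
  have hv : (ρ.asModuleEquiv.symm v) ∈ sSup {m : Submodule (MonoidAlgebra k A) ρ.asModule |
      IsSimpleModule (MonoidAlgebra k A) m} := by rw [htop]; trivial
  rw [sSup_eq_iSup'] at hv
  suffices h : ∀ w : ρ.asModule, w ∈ (⨆ S : {m : Submodule (MonoidAlgebra k A) ρ.asModule |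
      IsSimpleModule (MonoidAlgebra k A) m}, (S : Submodule (MonoidAlgebra k A) ρ.asModule)) →
      ρ.asModuleEquiv w ∈ ⨆ (B : Subgroup A) (_ : IsCoatom B), fixedVectors ρ B by
    simpa using h _ hv
  intro w hw
  induction hw using Submodule.iSup_induction' with
  | zero => simp
  | add x y _ _ hx hy => rw [map_add]; exact add_mem hx hy
  | mem S w hw =>
    obtain ⟨S, hS⟩ := S
    have hS : IsSimpleModule (MonoidAlgebra k A) S := hS
    obtain ⟨I, hI, ⟨φ⟩⟩ := isSimpleModule_iff_quot_maximal.mp hS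
    have hdom : IsDomain (MonoidAlgebra k A ⧸ I) := Ideal.Quotient.isDomain I
    let ψ : A →* (MonoidAlgebra k A ⧸ I) :=
      (Ideal.Quotient.mk I : MonoidAlgebra k A →* _).comp (MonoidAlgebra.of k A)
    have hker : ∀ b, ψ b = 1 → ∀ s ∈ S, ρ b (ρ.asModuleEquiv s) = ρ.asModuleEquiv s := by
      intro b hb s hs
      have h1 : MonoidAlgebra.of k A b • (⟨s, hs⟩ : S) = ⟨s, hs⟩ := by
        apply φ.injective
        rw [map_smul]
        obtain ⟨t, ht⟩ := Ideal.Quotient.mk_surjective (φ ⟨s, hs⟩)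
        rw [← ht]
        have : MonoidAlgebra.of k A b • (Ideal.Quotient.mk I t) =
          ψ b * Ideal.Quotient.mk I t := rfl
        rw [this, hb, one_mul]
      have h2 : MonoidAlgebra.of k A b • s = s := congrArg Subtype.val h1
      have h3 := ρ.asModuleEquiv_map_smul (MonoidAlgebra.of k A b) s
      rw [h2, Representation.asAlgebraHom_of] at h3
      exact h3.symm
    refine Submodule.mem_iSup_of_mem ψ.ker (Submodule.mem_iSup_of_mem ?_ ?_)
    · constructor
      · intro htop
        have h1 : ∀ s ∈ S, s = 0 := by
          intro s hs
          have h2 : ρ.asModuleEquiv s ∈ fixedVectors ρ ⊤ := by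
            intro b _
            refine hker b ?_ s hs
            exact MonoidHom.mem_ker.mp (htop ▸ Subgroup.mem_top b)
          rw [hfix, Submodule.mem_bot] at h2
          simpa using h2
        have := IsSimpleModule.nontrivial (MonoidAlgebra k A) S
        obtain ⟨s, hs⟩ := exists_ne (0 : S)
        exact hs (Subtype.ext (h1 s s.2))
      · intro D hD
        obtain ⟨a, haD, haK⟩ := SetLike.exists_of_lt hD
        have hψp : ∀ c, ψ c ^ p = 1 := fun c => by rw [← map_pow, hexp, map_one]
        have hprim : IsPrimitiveRoot (ψ a) p := by
          have : orderOf (ψ a) = p :=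
            orderOf_eq_prime_iff (hp := ⟨hp⟩) |>.mpr ⟨hψp a, fun h => haK (MonoidHom.mem_ker.mpr h)⟩
          rw [← this]; exact IsPrimitiveRoot.orderOf _
        rw [Subgroup.eq_top_iff']
        intro c
        have : NeZero p := ⟨hp.ne_zero⟩
        obtain ⟨i, -, hi⟩ := hprim.eq_pow_of_pow_eq_one (hψp c)
        have h1 : c * (a ^ i)⁻¹ ∈ ψ.ker := by
          rw [MonoidHom.mem_ker, map_mul, ← hi, ← map_pow, ← map_mul, mul_inv_cancel, map_one]
        simpa using mul_mem (hD.le h1) (pow_mem haD i)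
    · exact fun b hb => hker b (MonoidHom.mem_ker.mp hb) w hw

theorem mem_iSup_fixedVectors_of_covBy {A : Subgroup H} [Finite A] {p : ℕ} (hp : p.Prime)
    (hcomm : ∀ a ∈ A, ∀ b ∈ A, Commute a b) (hexp : ∀ a ∈ A, a ^ p = 1)
    (hk : (Nat.card A : k) ≠ 0) (ρ : Representation k H V) (hfix : fixedVectors ρ A = ⊥) (v : V) :
    v ∈ ⨆ (B : Subgroup H) (_ : B ⋖ A), fixedVectors ρ B := by
  let _ : CommGroup A := { (inferInstance : Group A) with
    mul_comm := fun a b => Subtype.ext (hcomm a a.2 b b.2) }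
  have h1 := mem_iSup_fixedVectors_of_isCoatom (A := A) hp
    (fun a => Subtype.ext (hexp a a.2)) hk (ρ.comp A.subtype) ?_ v
  · refine (iSup₂_le fun B hB => ?_ : (⨆ (B : Subgroup A) (_ : IsCoatom B),
      fixedVectors (ρ.comp A.subtype) B) ≤ _) h1
    have hcov : B.map A.subtype ⋖ A := by
      refine ⟨lt_of_le_of_ne (Subgroup.map_subtype_le B) ?_, ?_⟩
      · intro h
        refine hB.1 ?_
        rw [Subgroup.eq_top_iff']
        intro a
        obtain ⟨b, hb, hba⟩ := (show (a : H) ∈ B.map A.subtype by rw [h]; exact a.2)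
        rwa [← Subtype.ext hba]
      · intro D hBD hDA
        have h2 : B < D.subgroupOf A := by
          refine lt_of_le_of_ne ?_ ?_
          · intro b hb
            exact hBD.le ⟨b, hb, rfl⟩
          · rintro rfl
            rw [Subgroup.subgroupOf_map_subtype, inf_eq_left.mpr hDA.le] at hBD
            exact lt_irrefl _ hBD
        have h3 := hB.2 _ h2
        rw [Subgroup.subgroupOf_eq_top] at h3
        exact absurd h3 (not_le_of_gt hDA)
    refine le_trans ?_ (le_iSup₂_of_le (B.map A.subtype) hcov le_rfl)
    rintro w hw _ ⟨b, hb, rfl⟩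
    exact hw b hb
  · rw [eq_bot_iff, ← hfix]
    exact fun w hw a ha => hw ⟨a, ha⟩ trivial

/-- The sum of the operators of a subgroup. -/
noncomputable def sumOperators (ρ : Representation k H V) (B : Subgroup H) [Finite B] :
    V →ₗ[k] V :=
  letI := Fintype.ofFinite B
  ∑ b : B, ρ b

theorem sumOperators_apply_of_mem {ρ : Representation k H V} {B : Subgroup H} [Finite B] {v : V}
    (hv : v ∈ fixedVectors ρ B) : sumOperators ρ B v = (Nat.card B : k) • v := by
  let _ := Fintype.ofFinite B
  have h : ∀ b : B, ρ b v = v := fun b => hv b b.2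
  rw [sumOperators, LinearMap.sum_apply, Fintype.sum_congr _ _ h, Finset.sum_const, Finset.card_univ, Nat.card_eq_fintype_card, Nat.cast_smul_eq_nsmul]

theorem sumOperators_mem (ρ : Representation k H V) (B : Subgroup H) [Finite B] (v : V) :
    sumOperators ρ B v ∈ fixedVectors ρ B := by
  let _ := Fintype.ofFinite B
  intro c hc
  rw [sumOperators, LinearMap.sum_apply, map_sum]
  refine Fintype.sum_equiv (Equiv.mulLeft (⟨c, hc⟩ : B)) _ _ fun b => ?_
  simp [map_mul]

theorem map_sumOperators_of_commute {ρ : Representation k H V} {B : Subgroup H} [Finite B] {h : H}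
    (hc : ∀ b ∈ B, Commute h b) (v : V) :
    ρ h (sumOperators ρ B v) = sumOperators ρ B (ρ h v) := by
  let _ := Fintype.ofFinite B
  rw [sumOperators, LinearMap.sum_apply, LinearMap.sum_apply, map_sum]
  refine Finset.sum_congr rfl fun b _ => ?_
  rw [← Module.End.mul_apply, ← Module.End.mul_apply, ← map_mul, ← map_mul, (hc b b.2).eq]

theorem CovBy_sup_eq {A B C : Subgroup H} (hB : B ⋖ A) (hC : C ⋖ A) (h : B ≠ C) : B ⊔ C = A := by
  refine (hB.eq_or_eq le_sup_left (sup_le hB.le hC.le)).resolve_left fun h1 => ?_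
  have h2 : C ≤ B := sup_eq_left.mp h1
  rcases hC.eq_or_eq h2 hB.le with h3 | h3
  · exact h h3
  · exact hB.lt.ne h3

/-- The sum over `B i` sends `w j`, for `j ≠ i`, to a vector fixed by `B i ⊔ B j = A`, hence to
zero, while it multiplies `w i` by the invertible scalar `|B i|`. -/
theorem eq_zero_of_sum_fixedVectors_eq_zero {A : Subgroup H} [Finite A]
    (hcomm : ∀ a ∈ A, ∀ b ∈ A, Commute a b) (hk : (Nat.card A : k) ≠ 0)
    {ρ : Representation k H V} (hfix : fixedVectors ρ A = ⊥) {ι : Type*} {s : Finset ι}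
    {B : ι → Subgroup H} (hB : ∀ i ∈ s, B i ⋖ A) (hinj : ∀ i ∈ s, ∀ j ∈ s, B i = B j → i = j)
    {w : ι → V} (hw : ∀ i ∈ s, w i ∈ fixedVectors ρ (B i)) (hsum : ∑ i ∈ s, w i = 0) :
    ∀ i ∈ s, w i = 0 := by
  intro i hi
  have hfin : Finite (B i) := Finite.of_injective _ (Subgroup.inclusion_injective (hB i hi).le)
  have h1 : ∀ j ∈ s, j ≠ i → sumOperators ρ (B i) (w j) = 0 := by
    intro j hj hji
    have h2 : sumOperators ρ (B i) (w j) ∈ fixedVectors ρ (B i ⊔ B j) := by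
      refine mem_fixedVectors_sup (sumOperators_mem ρ _ _) fun b hb => ?_
      rw [map_sumOperators_of_commute, hw j hj b hb]
      exact fun c hc => hcomm b ((hB j hj).le hb) c ((hB i hi).le hc)
    rw [CovBy_sup_eq (hB i hi) (hB j hj) fun h => hji (hinj i hi j hj h).symm, hfix] at h2
    simpa using h2
  have h3 := congrArg (sumOperators ρ (B i)) hsum
  rw [map_sum, map_zero, Finset.sum_eq_single_of_mem i hi h1,
    sumOperators_apply_of_mem (hw i hi)] at h3
  refine (smul_eq_zero.mp h3).resolve_left fun h4 => hk ?_
  obtain ⟨m, hm⟩ := Subgroup.card_dvd_of_le (hB i hi).le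
  rw [hm, Nat.cast_mul, h4, zero_mul]

end Representation

/-! ### Permuted direct summands and the fixed vector condition. -/

section

variable {k H V : Type*} [Field k] [Group H] [AddCommGroup V] [Module k V]

theorem map_component_eq {I : Type*} [Fintype I] {W : I → Submodule k V}
    (hind : ∀ w : I → V, (∀ i, w i ∈ W i) → ∑ i, w i = 0 → ∀ i, w i = 0) {T : V →ₗ[k] V}
    {σ : Equiv.Perm I} (hT : ∀ i, ∀ v ∈ W i, T v ∈ W (σ i)) {c : I → V} (hc : ∀ i, c i ∈ W i)
    (h : T (∑ i, c i) = ∑ i, c i) (i : I) : T (c i) = c (σ i) := by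
  have h1 := hind (fun j => T (c (σ.symm j)) - c j) (fun j => sub_mem ?_ (hc j)) ?_ (σ i)
  · simpa [sub_eq_zero] using h1
  · simpa using hT _ _ (hc (σ.symm j))
  · rw [Finset.sum_sub_distrib, Equiv.sum_comp σ.symm fun j => T (c j), ← map_sum, h, sub_self]

variable {I : Type*} [Finite I] [MulAction H I] {W : I → Submodule k V} {ρ : Representation k H V}
  {x : H}

/-- Test the hypothesis on a vector whose nonzero components are exactly those indexed by a given
set `S`. A conjugate of `x` fixing it stabilizes `S`, so `x` stabilizes a translate of `S`, and the
permutation criterion applies. -/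
theorem smul_eq_self_of_fixes_point_in_each_orbit
    (hind : ∀ [Fintype I], ∀ w : I → V, (∀ i, w i ∈ W i) → ∑ i, w i = 0 → ∀ i, w i = 0)
    (hW : ∀ h i, ∀ v ∈ W i, ρ h v ∈ W (h • i)) (hne : ∀ i, W i ≠ ⊥)
    {P : Subgroup H} [P.Normal] (hP : Group.IsNilpotent P) (hx : x ∈ P)
    (hfix : ∀ v, ∃ h, ρ x (ρ h v) = ρ h v) (i : I) : x • i = i := by
  classical
  let _ := Fintype.ofFinite I
  refine smul_eq_self_of_forall_set hP hx (fun S => ?_) i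
  choose u huW hu using fun i => (Submodule.ne_bot_iff _).mp (hne i)
  let c : I → V := fun i => if i ∈ S then u i else 0
  have hc : ∀ i, c i ∈ W i := by
    intro i
    by_cases hi : i ∈ S
    · simpa [c, hi] using huW i
    · simp [c, hi]
  obtain ⟨h, hh⟩ := hfix (∑ i, c i)
  have hfx : ρ (h⁻¹ * x * h) (∑ i, c i) = ∑ i, c i := by
    rw [map_mul, map_mul, Module.End.mul_apply, Module.End.mul_apply, hh,
      Representation.inv_self_apply]
  refine ⟨h, fun i hi => ⟨(h⁻¹ * x * h) • i, ?_, ?_⟩⟩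
  · have h1 := map_component_eq (σ := MulAction.toPerm (h⁻¹ * x * h)) hind
      (hW _) hc hfx i
    by_contra hj
    simp only [MulAction.toPerm_apply, c, hi, hj, if_true, if_false] at h1
    refine hu i ?_
    rw [← Representation.inv_self_apply ρ (h⁻¹ * x * h) (u i), h1, map_zero]
  · simp [mul_smul]

/-- This passes the orbit hypothesis to one summand and its stabilizer, for use in the induction.
Spread a translate of `w` over each summand in the orbit of `i`; any translate of this vector has an
`i`-component that is a translate of `w` by the stabilizer. -/
theorem exists_mem_stabilizer_of_fixes_point_in_each_orbit
    (hind : ∀ [Fintype I], ∀ w : I → V, (∀ i, w i ∈ W i) → ∑ i, w i = 0 → ∀ i, w i = 0)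
    (hW : ∀ h i, ∀ v ∈ W i, ρ h v ∈ W (h • i)) (hx : ∀ i : I, x • i = i)
    (hfix : ∀ v, ∃ h, ρ x (ρ h v) = ρ h v) {i : I} {w : V} (hw : w ∈ W i) :
    ∃ h ∈ MulAction.stabilizer H i, ρ x (ρ h w) = ρ h w := by
  classical
  let _ := Fintype.ofFinite I
  have hex : ∀ j : I, ∃ g : H, j ∈ MulAction.orbit H i → g • i = j := by
    intro j
    by_cases hj : j ∈ MulAction.orbit H i
    · obtain ⟨g, hg⟩ := hj
      exact ⟨g, fun _ => hg⟩
    · exact ⟨1, fun h => absurd h hj⟩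
  choose g hg using hex
  let c : I → V := fun j => if j ∈ MulAction.orbit H i then ρ (g j) w else 0
  have hc : ∀ j, c j ∈ W j := by
    intro j
    by_cases hj : j ∈ MulAction.orbit H i
    · have := hW (g j) i w hw
      rw [hg j hj] at this
      simpa [c, hj] using this
    · simp [c, hj]
  obtain ⟨h, hh⟩ := hfix (∑ j, c j)
  have hfx : ρ (h⁻¹ * x * h) (∑ i, c i) = ∑ i, c i := by
    rw [map_mul, map_mul, Module.End.mul_apply, Module.End.mul_apply, hh,
      Representation.inv_self_apply]
  have hj : h⁻¹ • i ∈ MulAction.orbit H i := MulAction.mem_orbit i h⁻¹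
  have h1 := map_component_eq (σ := MulAction.toPerm (h⁻¹ * x * h)) hind
    (hW _) hc hfx (h⁻¹ • i)
  have h2 : (h⁻¹ * x * h) • h⁻¹ • i = h⁻¹ • i := by simp [mul_smul, hx]
  rw [MulAction.toPerm_apply, h2] at h1
  simp only [c, hj, if_true] at h1
  refine ⟨h * g (h⁻¹ • i), ?_, ?_⟩
  · rw [MulAction.mem_stabilizer_iff, mul_smul, hg _ hj, smul_inv_smul]
  · have h3 := congrArg (ρ h) h1
    rw [map_mul, map_mul, Module.End.mul_apply, Module.End.mul_apply,
      Representation.self_inv_apply] at h3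
    rw [map_mul, Module.End.mul_apply]
    exact h3

end

/-! ### Cyclicity criteria and actions on small cyclic subgroups. -/

section

variable {H : Type*} [Group H]

theorem mem_zpowers_of_mem_zpowers_prime {p : ℕ} (hp : p.Prime) {a b : H} (hb : b ^ p = 1)
    (ha : a ∈ Subgroup.zpowers b) (ha1 : a ≠ 1) : b ∈ Subgroup.zpowers a := by
  obtain ⟨j, rfl⟩ := Subgroup.mem_zpowers_iff.mp ha
  refine mem_zpowers_zpow_of_not_dvd (k := 1) hp (by simpa using hb) ?_
  rintro ⟨i, rfl⟩
  refine ha1 ?_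
  rw [zpow_mul, zpow_natCast, hb, one_zpow]

/-- A finite commutative `p`-group with at most one subgroup of order `p` is cyclic. -/
theorem exists_eq_zpowers_of_forall_prime_order [Finite H] {p : ℕ} (hp : p.Prime) {D : Subgroup H}
    (hD : IsPGroup p D) (hcomm : ∀ a ∈ D, ∀ b ∈ D, Commute a b)
    (h : ∀ a ∈ D, ∀ b ∈ D, a ^ p = 1 → b ^ p = 1 → a ≠ 1 → b ∈ Subgroup.zpowers a) :
    ∃ c, D = Subgroup.zpowers c := by
  have hexp : ∀ e ∈ D, ∃ k : ℕ, e ^ p ^ k = 1 := by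
    intro e he
    obtain ⟨k, hk⟩ := hD ⟨e, he⟩
    exact ⟨k, by simpa [Subtype.ext_iff] using hk⟩
  -- A maximal cyclic subgroup `⟨d⟩` is all of `D`. Otherwise take `y'` outside with `y' ^ p`
  -- inside: either `y' ^ p` generates `⟨d⟩`, against maximality, or a power of `d` corrects `y'` to
  -- an element of exponent `p`, which the hypothesis places in `⟨d⟩`.
  obtain ⟨Z, hZ⟩ := (Set.toFinite {Z : Subgroup H | ∃ d ∈ D, Z = Subgroup.zpowers d}).exists_maximal
    ⟨_, 1, one_mem _, rfl⟩
  obtain ⟨d, hd, rfl⟩ := hZ.prop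
  refine ⟨d, le_antisymm (fun y hy => ?_) (by simpa using hd)⟩
  by_contra hyd
  obtain ⟨k, hk⟩ := hexp y hy
  obtain ⟨i, hi1, hi2⟩ := exists_pow_not_mem_and_pow_mem hyd (p := p) (k := k)
    (by rw [hk]; exact one_mem _)
  have hyD : y ^ p ^ i ∈ D := pow_mem hy _
  set y' := y ^ p ^ i
  obtain ⟨j, hj⟩ := Subgroup.mem_zpowers_iff.mp hi2
  obtain ⟨l, hl⟩ := hexp d hd
  by_cases hpj : (p : ℤ) ∣ j
  · obtain ⟨j', rfl⟩ := hpj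
    have h1 : (y' * (d ^ j')⁻¹) ^ p = 1 := by
      rw [(hcomm _ hyD _ (inv_mem (zpow_mem hd j'))).mul_pow, ← hj, inv_pow, ← zpow_natCast (d ^ j'),
        ← zpow_mul, mul_comm j', mul_inv_cancel]
    have hmem : y' * (d ^ j')⁻¹ ∈ D := mul_mem hyD (inv_mem (zpow_mem hd j'))
    suffices hs : y' * (d ^ j')⁻¹ ∈ Subgroup.zpowers d by
      exact hi1 (by simpa using mul_mem hs (Subgroup.zpow_mem_zpowers d j'))
    by_cases hd1 : d = 1
    · have h2 : Subgroup.zpowers d ≤ Subgroup.zpowers y' := by simp [hd1]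
      exact absurd (hZ.le_of_ge ⟨y', hyD, rfl⟩ h2 (Subgroup.mem_zpowers y')) hi1
    · obtain ⟨t, ht1, ht2⟩ := exists_pow_not_mem_and_pow_mem (N := ⊥) (y := d) (by simpa using hd1)
        (p := p) (k := l) (by simpa using hl)
      exact Subgroup.zpowers_le.mpr (Subgroup.npow_mem_zpowers d _)
        (h _ (pow_mem hd _) _ hmem (by simpa using ht2) h1 (by simpa using ht1))
  · have h1 : Subgroup.zpowers d ≤ Subgroup.zpowers y' := by
      rw [Subgroup.zpowers_le]
      have h2 := mem_zpowers_zpow_of_not_dvd hp hl hpj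
      rw [hj] at h2
      exact Subgroup.zpowers_le.mpr (Subgroup.npow_mem_zpowers y' p) h2
    exact hi1 (hZ.le_of_ge ⟨y', hyD, rfl⟩ h1 (Subgroup.mem_zpowers y'))

theorem conj_eq_or_eq_inv_of_pow_four {c : H} (hc : (Subgroup.zpowers c).Normal) (h4 : c ^ 4 = 1)
    (y : H) : y * c * y⁻¹ = c ∨ y * c * y⁻¹ = c⁻¹ := by
  obtain ⟨r, hr⟩ := Subgroup.mem_zpowers_iff.mp (hc.conj_mem c (Subgroup.mem_zpowers c) y)
  obtain ⟨s, hs⟩ := Subgroup.mem_zpowers_iff.mp (hc.conj_mem c (Subgroup.mem_zpowers c) y⁻¹)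
  have hrs : c ^ (r * s) = c := by
    rw [zpow_mul, hr, conj_zpow, hs]; group
  have h4' : c ^ (4 : ℤ) = 1 := by exact_mod_cast h4
  rcases Int.emod_two_eq_zero_or_one r with h | h
  · obtain ⟨t, rfl⟩ : (2 : ℤ) ∣ r := Int.dvd_of_emod_eq_zero h
    have h2 : c ^ (2 : ℤ) = 1 := by
      calc c ^ (2 : ℤ) = (c ^ (2 * t * s)) ^ (2 : ℤ) := by rw [hrs]
        _ = (c ^ (4 : ℤ)) ^ (t * s) := by rw [← zpow_mul, ← zpow_mul]; congr 1; ring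
        _ = 1 := by rw [h4', one_zpow]
    have h1 : c = 1 := by rw [← hrs, mul_assoc, zpow_mul, h2, one_zpow]
    left; rw [h1]; simp
  · rw [← hr]
    have : r % 4 = 1 ∨ r % 4 = 3 := by omega
    rcases this with h' | h'
    · left
      obtain ⟨t, ht⟩ : ∃ t, r = 4 * t + 1 := ⟨r / 4, by omega⟩
      rw [ht, zpow_add, zpow_mul, h4', one_zpow, zpow_one, one_mul]
    · right
      obtain ⟨t, ht⟩ : ∃ t, r = 4 * t - 1 := ⟨r / 4 + 1, by omega⟩
      rw [ht, zpow_sub, zpow_mul, h4', one_zpow, zpow_one, one_mul]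

theorem sq_commute_of_pow_four {c : H} (hc : (Subgroup.zpowers c).Normal) (h4 : c ^ 4 = 1)
    (y : H) : Commute (y ^ 2) c := by
  have h : y * (y * c * y⁻¹) * y⁻¹ = c := by
    rcases conj_eq_or_eq_inv_of_pow_four hc h4 y with h | h
    · rw [h, h]
    · rw [h, ← conj_inv, h, inv_inv]
  show y ^ 2 * c = c * y ^ 2
  nth_rewrite 2 [← h]
  rw [pow_two]; group

/-- If `y` raises `c` to the power `r`, then `y ^ p ^ k = 1` raises it to `r ^ p ^ k`, which is `r`
modulo `p` by Fermat. -/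
theorem commute_of_zpowers_normal_of_pow_prime {p : ℕ} (hp : p.Prime) {c : H}
    (hc : (Subgroup.zpowers c).Normal) (hcp : c ^ p = 1) {y : H} {k : ℕ} (hy : y ^ p ^ k = 1) :
    Commute y c := by
  obtain ⟨r, hr⟩ := Subgroup.mem_zpowers_iff.mp (hc.conj_mem c (Subgroup.mem_zpowers c) y)
  have h3 : ∀ q : ℕ, y ^ q * c * (y ^ q)⁻¹ = c ^ (r ^ q) := by
    intro q
    induction q with
    | zero => simp
    | succ q ih =>
      calc y ^ (q + 1) * c * (y ^ (q + 1))⁻¹ = y * (y ^ q * c * (y ^ q)⁻¹) * y⁻¹ := by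
            rw [pow_succ']; group
        _ = _ := by rw [ih, ← conj_zpow, ← hr, ← zpow_mul, pow_succ']
  have h4 : c ^ r = c ^ (r ^ p ^ k) := by
    have : Fact p.Prime := ⟨hp⟩
    have h5 : (p : ℤ) ∣ r - r ^ p ^ k := by
      rw [← ZMod.intCast_zmod_eq_zero_iff_dvd]
      push_cast
      rw [ZMod.pow_card_pow, sub_self]
    obtain ⟨t, ht⟩ := h5
    rw [show c ^ r = c ^ (p * t + r ^ p ^ k) by rw [← ht, sub_add_cancel], zpow_add, zpow_mul, zpow_natCast, hcp, one_zpow, one_mul]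
  rw [← h3, hy, hr] at h4
  show y * c = c * y
  rw [← mul_inv_eq_iff_eq_mul, h4]; simp

end

/-! ### Conjugate fixed spaces and the case of odd `p`. -/

section

variable {k H V : Type*} [Field k] [Group H] [AddCommGroup V] [Module k V]

theorem map_conj_mul (g h : H) (B : Subgroup H) :
    B.map (MulAut.conj (g * h)).toMonoidHom =
      (B.map (MulAut.conj h).toMonoidHom).map (MulAut.conj g).toMonoidHom := by
  rw [Subgroup.map_map]
  congr 1
  ext x
  simp [MulAut.conj_apply]

theorem map_conj_one (B : Subgroup H) : B.map (MulAut.conj (1 : H)).toMonoidHom = B := by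
  ext x
  simp

theorem map_conj_inv_eq_iff {g : H} {B C : Subgroup H} :
    B.map (MulAut.conj g).toMonoidHom = C ↔ B = C.map (MulAut.conj g⁻¹).toMonoidHom := by
  constructor
  · rintro rfl
    rw [← map_conj_mul, inv_mul_cancel, map_conj_one]
  · rintro rfl
    rw [← map_conj_mul, mul_inv_cancel, map_conj_one]

theorem map_conj_eq_of_commute {g : H} {B : Subgroup H} (h : ∀ b ∈ B, Commute g b) :
    B.map (MulAut.conj g).toMonoidHom = B := by
  have h1 : ∀ b ∈ B, g * b * g⁻¹ = b := fun b hb => by rw [(h b hb).eq, mul_inv_cancel_right]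
  ext x
  constructor
  · rintro ⟨b, hb, rfl⟩
    have : (MulAut.conj g).toMonoidHom b = b := h1 b hb
    rw [this]; exact hb
  · exact fun hx => ⟨x, hx, h1 x hx⟩

theorem map_conj_covBy {g : H} {A B : Subgroup H} (hA : A.map (MulAut.conj g).toMonoidHom = A)
    (hB : B ⋖ A) : B.map (MulAut.conj g).toMonoidHom ⋖ A := by
  have hmono : ∀ {g : H} {B C : Subgroup H}, B < C →
      B.map (MulAut.conj g).toMonoidHom < C.map (MulAut.conj g).toMonoidHom := fun {g B C} h =>
    (Subgroup.map_lt_map_iff_of_injective (MulAut.conj g).injective).mpr h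
  constructor
  · conv_rhs => rw [← hA]
    exact hmono hB.lt
  · intro C hBC hCA
    refine hB.2 (c := C.map (MulAut.conj g⁻¹).toMonoidHom) ?_ ?_
    · rw [map_conj_inv_eq_iff.mp (rfl : B.map (MulAut.conj g).toMonoidHom = _)]
      exact hmono hBC
    · rw [map_conj_inv_eq_iff.mp hA]
      exact hmono hCA

theorem sum_fixedVectors_independent {A : Subgroup H} [Finite A]
    (hcomm : ∀ a ∈ A, ∀ b ∈ A, Commute a b) (hk : (Nat.card A : k) ≠ 0)
    {ρ : Representation k H V} (hfix : fixedVectors ρ A = ⊥) {q : Subgroup H → Prop}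
    (hq : ∀ B, q B → B ⋖ A) [Fintype {B : Subgroup H // q B}]
    (w : {B : Subgroup H // q B} → V) (hw : ∀ i, w i ∈ fixedVectors ρ i.1)
    (hsum : ∑ i, w i = 0) (i : {B : Subgroup H // q B}) : w i = 0 :=
  eq_zero_of_sum_fixedVectors_eq_zero hcomm hk hfix (s := Finset.univ) (B := fun i => i.1)
    (fun i _ => hq i.1 i.2) (fun _ _ _ _ h => Subtype.ext h) (fun i _ => hw i) hsum i
    (Finset.mem_univ i)

/-- Split `V` under a maximal commutative subgroup `A` of `E` and take a summand fixed by `B`, so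
that `A = B × M`. The `E`-conjugates of `B` correspond to the cosets of `A` in `E`, and `P` acts on
them compatibly with translation. A vector supported on all of them except `B` itself forces a
conjugate of `x` to fix every such conjugate; comparing its scalars at `e` and `e * e` then kills
the commutator with `e`. -/
theorem commute_of_fixes_point_in_each_orbit_of_odd [Finite H] [Nontrivial V] {p : ℕ}
    (hp : p.Prime) (hp2 : p ≠ 2) (hpk : (p : k) ≠ 0) (ρ : Representation k H V) {P E : Subgroup H}
    [P.Normal] (hP : IsPGroup p P) [hEn : E.Normal] (hEP : E ≤ P)
    (hE : ¬ ∀ a ∈ E, ∀ b ∈ E, Commute a b) {m : H} (hMn : (Subgroup.zpowers m).Normal)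
    (hm : ∀ a, a ∈ Subgroup.zpowers m ↔ a ∈ E ∧ ∀ e ∈ E, Commute e a)
    (hcomm : ∀ e ∈ E, ∀ y ∈ P, y * e * y⁻¹ * e⁻¹ ∈ Subgroup.zpowers m)
    (hexp : ∀ e ∈ E, e ^ p = 1) (hfixM : fixedVectors ρ (Subgroup.zpowers m) = ⊥) {x : H}
    (hx : x ∈ P) (hfix : ∀ v, ∃ h, ρ x (ρ h v) = ρ h v) : ∀ e ∈ E, Commute x e := by
  classical
  set M := Subgroup.zpowers m with hM
  have hmM : m ∈ M := Subgroup.mem_zpowers m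
  have hME : M ≤ E := fun a ha => ((hm a).mp ha).1
  have hMcent : ∀ a ∈ M, ∀ e ∈ E, Commute e a := fun a ha => ((hm a).mp ha).2
  have hMgen : ∀ a ∈ M, a ≠ 1 → M ≤ Subgroup.zpowers a := by
    intro a ha ha1
    rw [hM, Subgroup.zpowers_le]
    exact mem_zpowers_of_mem_zpowers_prime hp (hexp m (hME hmM)) ha ha1
  have hPm : ∀ y ∈ P, ∀ a ∈ M, Commute y a := by
    intro y hy a ha
    obtain ⟨l, hl⟩ := hP ⟨y, hy⟩
    obtain ⟨i, rfl⟩ := Subgroup.mem_zpowers_iff.mp ha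
    exact (commute_of_zpowers_normal_of_pow_prime hp hMn (hexp m (hME hmM))
      (by simpa [Subtype.ext_iff] using hl)).zpow_right i
  -- a maximal commutative subgroup of `E`
  obtain ⟨A, hAmax⟩ := (Set.toFinite {A : Subgroup H | A ≤ E ∧ M ≤ A ∧
    ∀ a ∈ A, ∀ b ∈ A, Commute a b}).exists_maximal
    ⟨M, hME, le_rfl, fun a ha b hb => hMcent b hb a (hME ha)⟩
  obtain ⟨hAE, hMA, hAcomm⟩ := hAmax.prop
  have hAself : ∀ e ∈ E, (∀ a ∈ A, Commute e a) → e ∈ A := by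
    intro e he hea
    have hle : A ⊔ Subgroup.zpowers e ≤ Subgroup.centralizer (A ⊔ Subgroup.zpowers e : Subgroup H) := by
      have h1 : A ⊔ Subgroup.zpowers e ≤ Subgroup.centralizer (A : Set H) := by
        refine sup_le (fun a ha => ?_) ?_
        · exact Subgroup.mem_centralizer_iff.mpr fun b hb => hAcomm b hb a ha
        · rw [Subgroup.zpowers_le]
          exact Subgroup.mem_centralizer_iff.mpr fun b hb => (hea b hb).symm
      have h2 : A ⊔ Subgroup.zpowers e ≤ Subgroup.centralizer ({e} : Set H) := by
        refine sup_le (fun a ha => ?_) ?_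
        · exact Subgroup.mem_centralizer_singleton_iff.mpr (hea a ha).symm
        · rw [Subgroup.zpowers_le]
          exact Subgroup.mem_centralizer_singleton_iff.mpr rfl
      refine sup_le (fun a ha => ?_) ?_
      · exact Subgroup.mem_centralizer_iff.mpr fun b hb =>
          (Subgroup.mem_centralizer_iff.mp (h1 hb) a ha).symm
      · rw [Subgroup.zpowers_le]
        exact Subgroup.mem_centralizer_iff.mpr fun b hb =>
          Subgroup.mem_centralizer_singleton_iff.mp (h2 hb)
    refine hAmax.le_of_ge (y := A ⊔ Subgroup.zpowers e) ⟨sup_le hAE (by simpa using he),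
      hMA.trans le_sup_left, fun a ha b hb => ?_⟩ le_sup_left
      (Subgroup.mem_sup_right (Subgroup.mem_zpowers e))
    exact (Subgroup.mem_centralizer_iff.mp (hle ha) b hb).symm
  have hfixA : fixedVectors ρ A = ⊥ := by
    rw [eq_bot_iff, ← hfixM]
    exact fun v hv a ha => hv a (hMA ha)
  have hcardA : (Nat.card A : k) ≠ 0 := by
    have : Fact p.Prime := ⟨hp⟩
    obtain ⟨j, hj⟩ := IsPGroup.iff_card.mp (hP.to_le (hAE.trans hEP))
    rw [hj, Nat.cast_pow]
    exact pow_ne_zero _ hpk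
  obtain ⟨B, hBA, hB⟩ : ∃ B, B ⋖ A ∧ fixedVectors ρ B ≠ ⊥ := by
    by_contra hcon
    push Not at hcon
    obtain ⟨v, hv⟩ := exists_ne (0 : V)
    have h1 := mem_iSup_fixedVectors_of_covBy hp hAcomm (fun a ha => hexp a (hAE ha)) hcardA ρ
      hfixA v
    have h2 : (⨆ (B : Subgroup H) (_ : B ⋖ A), fixedVectors ρ B) = ⊥ := by
      rw [eq_bot_iff]; exact iSup₂_le fun B hB => (hcon B hB).le
    rw [h2] at h1
    exact hv (by simpa using h1)
  obtain ⟨v0, hv0B, hv0⟩ := (Submodule.ne_bot_iff _).mp hB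
  have hMfix : ∀ a ∈ M, ρ a v0 = v0 → a = 1 := by
    intro a ha hav
    by_contra ha1
    have h1 : v0 ∈ fixedVectors ρ M := by
      exact fun b hb => mem_fixedVectors_zpowers hav b (hMgen a ha ha1 hb)
    rw [hfixM] at h1
    exact hv0 (by simpa using h1)
  have hBM : ∀ b ∈ B, b ∈ M → b = 1 := fun b hb hbM => hMfix b hbM (hv0B b hb)
  have hMB : ¬ M ≤ B := by
    intro h
    have h1 : v0 ∈ fixedVectors ρ M := fun a ha => hv0B a (h ha)
    rw [hfixM] at h1
    exact hv0 (by simpa using h1)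
  have hBMA : B ⊔ M = A := by
    refine (hBA.eq_or_eq le_sup_left (sup_le hBA.le hMA)).resolve_left fun h => hMB ?_
    rw [← h]; exact le_sup_right
  let c : H → Subgroup H := fun g => B.map (MulAut.conj g).toMonoidHom
  have hcmul : ∀ g h, c (g * h) = (c h).map (MulAut.conj g).toMonoidHom :=
    fun g h => map_conj_mul g h B
  have hA : ∀ g ∈ P, A.map (MulAut.conj g).toMonoidHom = A := by
    have hle : ∀ g ∈ P, A.map (MulAut.conj g).toMonoidHom ≤ A := by
      rintro g hg _ ⟨a, ha, rfl⟩
      have h1 := mul_mem (hMA (hcomm a (hAE ha) g hg)) ha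
      simpa [MulAut.conj_apply] using h1
    intro g hg
    refine le_antisymm (hle g hg) ?_
    have h1 := Subgroup.map_mono (f := (MulAut.conj g).toMonoidHom) (hle g⁻¹ (inv_mem hg))
    rwa [← map_conj_mul, mul_inv_cancel, map_conj_one] at h1
  have hccov : ∀ g ∈ P, c g ⋖ A := fun g hg => map_conj_covBy (hA g hg) hBA
  -- For `b ∈ B` the commutator with `g` lies in both `B` and `M`, which meet trivially.
  have hnorm : ∀ g ∈ P, c g = B → ∀ a ∈ A, Commute g a := by
    intro g hg hgB
    have h1 : B ⊔ M ≤ Subgroup.centralizer ({g} : Set H) := by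
      refine sup_le (fun b hb => ?_) fun a ha => ?_
      · have h2 : g * b * g⁻¹ * b⁻¹ ∈ M := hcomm b (hAE (hBA.le hb)) g hg
        have h3 : g * b * g⁻¹ ∈ B := by rw [← hgB]; exact ⟨b, hb, by simp [MulAut.conj_apply]⟩
        have h4 := hBM _ (mul_mem h3 (inv_mem hb)) h2
        rw [Subgroup.mem_centralizer_singleton_iff]
        exact (mul_inv_eq_iff_eq_mul.mp (mul_inv_eq_one.mp h4)).symm
      · exact Subgroup.mem_centralizer_singleton_iff.mpr (hPm g hg a ha).symm
    rw [hBMA] at h1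
    exact fun a ha => (Subgroup.mem_centralizer_singleton_iff.mp (h1 ha)).symm
  have hnormE : ∀ e ∈ E, c e = B → e ∈ A := fun e he h => hAself e he (hnorm e (hEP he) h)
  have hceq : ∀ e ∈ E, ∀ f ∈ E, c e = c f → e⁻¹ * f ∈ A := by
    intro e he f hf hef
    refine hnormE _ (mul_mem (inv_mem he) hf) ?_
    rw [hcmul, ← hef, ← hcmul, inv_mul_cancel]
    exact map_conj_one B
  -- The commutator of `y` and `t` lies in `M`, which centralizes every conjugate of `B`.
  have hswap : ∀ y ∈ P, ∀ t ∈ E, c (y * t) = c (t * y) := by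
    intro y hy t ht
    have hμ : t⁻¹ * y * t * y⁻¹ ∈ M := by
      have := inv_mem (hcomm t⁻¹ (inv_mem ht) y hy)
      simpa [mul_assoc] using this
    rw [show y * t = t * ((t⁻¹ * y * t * y⁻¹) * y) by group, hcmul, hcmul (t⁻¹ * y * t * y⁻¹),
      map_conj_eq_of_commute (g := t⁻¹ * y * t * y⁻¹)
        fun b hb => (hMcent _ hμ b (hAE ((hccov y hy).le hb))).symm, ← hcmul]
  -- the vector
  let q : Subgroup H → Prop := fun D => D ⋖ A
  let _ : Fintype {D : Subgroup H // q D} := Fintype.ofFinite _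
  have hex : ∀ D : Subgroup H, ∃ t : H, (∃ e ∈ E, e ∉ A ∧ c e = D) → t ∈ E ∧ t ∉ A ∧ c t = D := by
    intro D
    by_cases hD : ∃ e ∈ E, e ∉ A ∧ c e = D
    · obtain ⟨e, he⟩ := hD
      exact ⟨e, fun _ => he⟩
    · exact ⟨1, fun h => absurd h hD⟩
  choose r hr using hex
  -- The component at `B` is zero although `B` is an `E`-conjugate of itself. This single gap is
  -- what rules out a nontrivial translation.
  let u : {D : Subgroup H // q D} → V := fun D =>
    if ∃ e ∈ E, e ∉ A ∧ c e = D.1 then ρ (r D.1) v0 else 0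
  have hu : ∀ D, u D ∈ fixedVectors ρ D.1 := by
    intro D
    by_cases hD : ∃ e ∈ E, e ∉ A ∧ c e = D.1
    · have h1 := map_mem_fixedVectors_map_conj hv0B (r D.1)
      simp only [u, hD, if_true]
      rwa [show B.map (MulAut.conj (r D.1)).toMonoidHom = D.1 from (hr D.1 hD).2.2] at h1
    · simp only [u, hD, if_false]; exact zero_mem _
  obtain ⟨h, hh⟩ := hfix (∑ D, u D)
  have hyP : h⁻¹ * x * h ∈ P := by simpa using Subgroup.Normal.conj_mem ‹P.Normal› x hx h⁻¹
  have hyfix : ρ (h⁻¹ * x * h) (∑ D, u D) = ∑ D, u D := by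
    rw [map_mul, map_mul, Module.End.mul_apply, Module.End.mul_apply, hh,
      Representation.inv_self_apply]
  suffices hy : ∀ e ∈ E, Commute (h⁻¹ * x * h) e by
    intro e he
    have h1 := hy (h⁻¹ * e * h) (by simpa using hEn.conj_mem e he h⁻¹)
    have h2 : h * ((h⁻¹ * x * h) * (h⁻¹ * e * h)) * h⁻¹ = h * ((h⁻¹ * e * h) * (h⁻¹ * x * h)) * h⁻¹ := by
      rw [h1.eq]
    show x * e = e * x
    calc x * e = h * ((h⁻¹ * x * h) * (h⁻¹ * e * h)) * h⁻¹ := by group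
      _ = e * x := by rw [h2]; group
  generalize h⁻¹ * x * h = y at hyP hyfix ⊢
  let σ : Equiv.Perm {D : Subgroup H // q D} :=
    { toFun := fun D => ⟨D.1.map (MulAut.conj y).toMonoidHom, map_conj_covBy (hA y hyP) D.2⟩
      invFun := fun D => ⟨D.1.map (MulAut.conj y⁻¹).toMonoidHom,
        map_conj_covBy (hA y⁻¹ (inv_mem hyP)) D.2⟩
      left_inv := fun D => Subtype.ext (by
        show (D.1.map _).map _ = D.1
        rw [← map_conj_mul, inv_mul_cancel, map_conj_one])
      right_inv := fun D => Subtype.ext (by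
        show (D.1.map _).map _ = D.1
        rw [← map_conj_mul, mul_inv_cancel, map_conj_one]) }
  have hcompo : ∀ D, ρ y (u D) = u (σ D) :=
    map_component_eq (W := fun D => fixedVectors ρ D.1) (σ := σ)
      (fun w hw hs => sum_fixedVectors_independent hAcomm hcardA hfixA (fun _ h => h) w hw hs)
      (fun D v hv => map_mem_fixedVectors_map_conj hv y) hu hyfix
  have huval : ∀ t (htE : t ∈ E), t ∉ A → u ⟨c t, hccov t (hEP htE)⟩ = ρ (r (c t)) v0 := by
    intro t ht htA
    simp only [u]
    rw [if_pos ⟨t, ht, htA, rfl⟩]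
  have hmaps : ∀ t ∈ E, t ∉ A → ∃ e ∈ E, e ∉ A ∧ c e = c (y * t) := by
    intro t ht htA
    by_contra hcon
    have h1 := hcompo ⟨c t, hccov t (hEP ht)⟩
    rw [huval t ht htA] at h1
    have h2 : u (σ ⟨c t, hccov t (hEP ht)⟩) = 0 := by
      simp only [u]
      refine if_neg ?_
      show ¬ ∃ e ∈ E, e ∉ A ∧ c e = (c t).map (MulAut.conj y).toMonoidHom
      rwa [← hcmul]
    rw [h2] at h1
    refine hv0 ?_
    rw [← Representation.inv_self_apply ρ (r (c t)) v0,
      ← Representation.inv_self_apply ρ y (ρ (r (c t)) v0), h1, map_zero, map_zero]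
  have hneA : ∃ t ∈ E, t ∉ A := by
    by_contra hcon
    push Not at hcon
    exact hE fun a ha b hb => hAcomm a (hcon a ha) b (hcon b hb)
  -- `y` normalizes `B`
  have hyB : c y = B := by
    obtain ⟨t1, ht1, ht1A⟩ := hneA
    obtain ⟨t2, ht2, ht2A, ht12⟩ := hmaps t1 ht1 ht1A
    rw [hswap y hyP t1 ht1, hcmul] at ht12
    have h1 : c y = c (t1⁻¹ * t2) := by
      rw [hcmul, ht12, ← map_conj_mul, inv_mul_cancel, map_conj_one]
    have hsE : t1⁻¹ * t2 ∈ E := mul_mem (inv_mem ht1) ht2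
    set s := t1⁻¹ * t2
    -- `y` moves the conjugates of `B` as translation by `s` does. If `s ∉ A`, it would carry the
    -- conjugate by `s⁻¹`, in the support, to `B`, outside it.
    by_cases hsA : s ∈ A
    · rw [h1]
      exact map_conj_eq_of_commute fun b hb => hAcomm s hsA b (hBA.le hb)
    · obtain ⟨e, he, heA, hce⟩ := hmaps s⁻¹ (inv_mem hsE) (fun h => hsA (by simpa using inv_mem h))
      rw [hswap y hyP _ (inv_mem hsE), hcmul, h1, ← hcmul, inv_mul_cancel] at hce
      exact absurd (hnormE e he (hce.trans (map_conj_one B))) heA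
  have hyA : ∀ a ∈ A, Commute y a := hnorm y hyP hyB
  have hμmem : ∀ t ∈ E, t⁻¹ * y * t * y⁻¹ ∈ M := by
    intro t ht
    have := inv_mem (hcomm t⁻¹ (inv_mem ht) y hyP)
    simpa [mul_assoc] using this
  -- The component at the conjugate by `t` is fixed by `y`; transported back to `v0`, this says that
  -- the product of the commutator with `y` fixes `v0`.
  have hμfix : ∀ t ∈ E, t ∉ A → ρ (t⁻¹ * y * t * y⁻¹) (ρ y v0) = v0 := by
    intro t ht htA
    have h1 := hcompo ⟨c t, hccov t (hEP ht)⟩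
    have h2 : σ ⟨c t, hccov t (hEP ht)⟩ = ⟨c t, hccov t (hEP ht)⟩ := by
      refine Subtype.ext ?_
      show (c t).map (MulAut.conj y).toMonoidHom = c t
      rw [← hcmul, hswap y hyP t ht, hcmul, hyB]
    rw [h2, huval t ht htA] at h1
    obtain ⟨hrE, hrA, hrc⟩ := hr (c t) ⟨t, ht, htA, rfl⟩
    have ha := hceq t ht _ hrE hrc.symm
    have hrt : r (c t) = t * (t⁻¹ * r (c t)) := by group
    set a := t⁻¹ * r (c t)
    rw [hrt] at h1
    have h3 : y * (t * a) = t * a * ((t⁻¹ * y * t * y⁻¹) * y) := by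
      have h4 : Commute a ((t⁻¹ * y * t * y⁻¹) * y) :=
        (hMcent _ (hμmem t ht) a (hAE ha)).mul_right (hyA a ha).symm
      rw [mul_assoc t a, h4.eq]; group
    rw [← Module.End.mul_apply, ← map_mul, h3, map_mul, Module.End.mul_apply] at h1
    have h5 := congrArg (ρ (t * a)⁻¹) h1
    rwa [Representation.inv_self_apply, Representation.inv_self_apply, map_mul,
      Module.End.mul_apply] at h5
  intro e he
  by_cases heA : e ∈ A
  · exact hyA e heA
  -- Here `p` odd is used: `e` is a power of its square.
  have he2A : e * e ∉ A := by
    intro h2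
    refine heA ?_
    obtain ⟨j, hj⟩ := hp.odd_of_ne_two hp2
    have h3 : e = (e * e) ^ (j + 1) := by
      rw [← pow_two, ← pow_mul, show 2 * (j + 1) = p + 1 by omega, pow_succ, hexp e he, one_mul]
    rw [h3]; exact pow_mem h2 _
  have h1 := hμfix e he heA
  have h2 := hμfix (e * e) (mul_mem he he) he2A
  have hμ := hμmem e he
  have h3 : (e * e)⁻¹ * y * (e * e) * y⁻¹ = (e⁻¹ * y * e * y⁻¹) * (e⁻¹ * y * e * y⁻¹) := by
    have h4 : Commute (e⁻¹ * y * e * y⁻¹) (e⁻¹ * y * e * y⁻¹ * y) := by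
      exact (Commute.refl _).mul_right (hPm y hyP _ hμ).symm
    calc (e * e)⁻¹ * y * (e * e) * y⁻¹
        = e⁻¹ * (e⁻¹ * y * e * y⁻¹) * (y * e * y⁻¹) := by group
      _ = (e⁻¹ * y * e * y⁻¹) * e⁻¹ * (y * e * y⁻¹) := by
          rw [(hMcent _ hμ e⁻¹ (inv_mem he)).eq]
      _ = _ := by group
  rw [h3, map_mul, Module.End.mul_apply, h1] at h2
  -- For `e * e` the commutator is the square of the one for `e`. Both relations send `ρ y v0` back
  -- to `v0`, so the commutator itself fixes `v0`.
  have h4 := hMfix _ hμ h2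
  have h5 : e⁻¹ * y * e = y := mul_inv_eq_one.mp h4
  show y * e = e * y
  rw [mul_assoc, inv_mul_eq_iff_eq_mul] at h5
  exact h5

end

/-! ### Reduction to cyclic normal subgroups, and the induction on dimension. -/

section

variable {k H V : Type*} [Field k] [Group H] [AddCommGroup V] [Module k V]

theorem map_mem_fixedVectors_of_normal {ρ : Representation k H V} {A : Subgroup H} [hA : A.Normal]
    {v : V} (hv : v ∈ fixedVectors ρ A) (h : H) : ρ h v ∈ fixedVectors ρ A := by
  intro a ha
  have h1 : a * h = h * (h⁻¹ * a * h) := by group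
  rw [← Module.End.mul_apply, ← map_mul, h1, map_mul, Module.End.mul_apply,
    hv _ (by simpa using hA.conj_mem a ha h⁻¹)]

theorem map_sumOperators_of_normal {ρ : Representation k H V} {A : Subgroup H} [Finite A]
    [hA : A.Normal] (h : H) (v : V) : ρ h (sumOperators ρ A v) = sumOperators ρ A (ρ h v) := by
  let _ := Fintype.ofFinite A
  rw [sumOperators, LinearMap.sum_apply, LinearMap.sum_apply, map_sum]
  refine Fintype.sum_equiv (MulAut.conjNormal h).toEquiv _ _ fun b => ?_
  rw [← Module.End.mul_apply, ← Module.End.mul_apply, ← map_mul, ← map_mul]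
  congr 2
  simp

/-- A normal elementary abelian subgroup either splits `V` into proper pieces, to which `hIH`
applies, or is too small to do so. If `A` has nonzero fixed vectors, the pieces are the fixed space
and the kernel of the sum over `A`. If not, they are the fixed spaces of maximal subgroups `B`, each
stabilized by `x`; such a piece is proper unless `B` acts trivially, which by faithfulness means `B
= ⊥` and `A` of prime order. -/
theorem elementary_normal_subgroup_dichotomy [Finite H] {p : ℕ} (hp : p.Prime)
    {ρ : Representation k H V} (hfaith : ∀ h, (∀ v, ρ h v = v) → h = 1) {x z : H}
    (hfix : ∀ v, ∃ h, ρ x (ρ h v) = ρ h v)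
    (hIH : ∀ (L : Subgroup H) (W : Submodule k V), (∀ h ∈ L, ∀ v ∈ W, ρ h v ∈ W) → x ∈ L → W ≠ ⊤ →
      (∀ w ∈ W, ∃ h ∈ L, ρ x (ρ h w) = ρ h w) → ∀ w ∈ W, ρ z w = w)
    {P : Subgroup H} [P.Normal] (hP : Group.IsNilpotent P) (hx : x ∈ P) {A : Subgroup H}
    [hA : A.Normal] (hcomm : ∀ a ∈ A, ∀ b ∈ A, Commute a b) (hexp : ∀ a ∈ A, a ^ p = 1)
    (hAbot : A ≠ ⊥) (hk : (Nat.card A : k) ≠ 0) :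
    (∀ v, ρ z v = v) ∨ (fixedVectors ρ A = ⊥ ∧ ∃ c, A = Subgroup.zpowers c) := by
  by_cases hfixA : fixedVectors ρ A = ⊥
  · by_cases htop : ∃ B : Subgroup H, B ⋖ A ∧ fixedVectors ρ B = ⊤
    · right
      obtain ⟨B, hBA, hB⟩ := htop
      have hBbot : B = ⊥ := by
        rw [eq_bot_iff]
        intro b hb
        refine Subgroup.mem_bot.mpr (hfaith b fun v => ?_)
        have : v ∈ fixedVectors ρ B := hB ▸ Submodule.mem_top
        exact this b hb
      obtain ⟨a, ha, ha1⟩ := (Subgroup.ne_bot_iff_exists_ne_one.mp hAbot : ∃ a : A, a ≠ 1) |>.elim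
        fun a ha => (⟨a, a.2, fun h => ha (Subtype.ext h)⟩ : ∃ a ∈ A, a ≠ 1)
      refine ⟨hfixA, a, ?_⟩
      rcases hBA.eq_or_eq (c := Subgroup.zpowers a) (by rw [hBbot]; exact bot_le)
        (by simpa using ha) with h | h
      · rw [hBbot, Subgroup.zpowers_eq_bot] at h; exact absurd h ha1
      · exact h.symm
    · left
      push Not at htop
      let q : Subgroup H → Prop := fun B => B ⋖ A ∧ fixedVectors ρ B ≠ ⊥
      have hconjA : ∀ h : H, A.map (MulAut.conj h).toMonoidHom = A := fun h =>
        Subgroup.Normal.map_conj_eq A h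
      let _ : MulAction H {B : Subgroup H // q B} :=
        { smul := fun h B => ⟨B.1.map (MulAut.conj h).toMonoidHom,
            map_conj_covBy (hconjA h) B.2.1, by
              obtain ⟨v, hv, hv0⟩ := (Submodule.ne_bot_iff _).mp B.2.2
              refine (Submodule.ne_bot_iff _).mpr
                ⟨ρ h v, map_mem_fixedVectors_map_conj hv h, fun h0 => hv0 ?_⟩
              rw [← Representation.inv_self_apply ρ h v, h0, map_zero]⟩
          one_smul := fun B => Subtype.ext (map_conj_one B.1)
          mul_smul := fun g h B => Subtype.ext (map_conj_mul g h B.1) }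
      let W : {B : Subgroup H // q B} → Submodule k V := fun B => fixedVectors ρ B.1
      have hind : ∀ [Fintype {B : Subgroup H // q B}], ∀ w : {B : Subgroup H // q B} → V,
          (∀ i, w i ∈ W i) → ∑ i, w i = 0 → ∀ i, w i = 0 := by
        intro _ w hw hs
        exact sum_fixedVectors_independent hcomm hk hfixA (fun _ h => h.1) w hw hs
      have hW : ∀ (h : H) (i : {B : Subgroup H // q B}), ∀ v ∈ W i, ρ h v ∈ W (h • i) :=
        fun h i v hv => map_mem_fixedVectors_map_conj hv h
      have hxI : ∀ i : {B : Subgroup H // q B}, x • i = i :=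
        smul_eq_self_of_fixes_point_in_each_orbit hind hW (fun i => i.2.2) hP hx hfix
      have hz : ∀ i : {B : Subgroup H // q B}, ∀ w ∈ W i, ρ z w = w := by
        intro i
        refine hIH (MulAction.stabilizer H i) (W i) ?_ (hxI i) (htop i.1 i.2.1) ?_
        · intro h hh v hv
          have := hW h i v hv
          rwa [MulAction.mem_stabilizer_iff.mp hh] at this
        · intro w hw
          exact exists_mem_stabilizer_of_fixes_point_in_each_orbit hind hW hxI hfix hw
      intro v
      have h1 := mem_iSup_fixedVectors_of_covBy hp hcomm hexp hk ρ hfixA v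
      have h2 : (⨆ (B : Subgroup H) (_ : B ⋖ A), fixedVectors ρ B) ≤
          LinearMap.eqLocus (ρ z) LinearMap.id := by
        refine iSup₂_le fun B hB w hw => ?_
        by_cases hw0 : w = 0
        · rw [hw0]; exact zero_mem _
        · exact hz ⟨B, hB, (Submodule.ne_bot_iff _).mpr ⟨w, hw, hw0⟩⟩ w hw
      exact h2 h1
  · left
    obtain ⟨v0, hv0, hv0'⟩ := (Submodule.ne_bot_iff _).mp hfixA
    have hF : ∀ w ∈ fixedVectors ρ A, ρ z w = w := by
      refine hIH ⊤ _ (fun h _ v hv => map_mem_fixedVectors_of_normal hv h) trivial ?_ ?_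
      · intro h
        refine hAbot (eq_bot_iff.mpr fun a ha => Subgroup.mem_bot.mpr (hfaith a fun v => ?_))
        have : v ∈ fixedVectors ρ A := h ▸ Submodule.mem_top
        exact this a ha
      · exact fun w _ => (hfix w).imp fun h hh => ⟨trivial, hh⟩
    have hN : ∀ w ∈ LinearMap.ker (sumOperators ρ A), ρ z w = w := by
      refine hIH ⊤ _ (fun h _ v hv => ?_) trivial ?_ ?_
      · rw [LinearMap.mem_ker] at hv ⊢
        rw [← map_sumOperators_of_normal, hv, map_zero]
      · intro h
        have h1 : v0 ∈ LinearMap.ker (sumOperators ρ A) := h ▸ Submodule.mem_top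
        rw [LinearMap.mem_ker, sumOperators_apply_of_mem hv0] at h1
        exact (smul_ne_zero hk hv0') h1
      · exact fun w _ => (hfix w).imp fun h hh => ⟨trivial, hh⟩
    intro v
    -- Up to the invertible factor `|A|`, `v` is the sum of the fixed vector `s` and a vector in the
    -- kernel of the sum over `A`.
    set s := sumOperators ρ A v with hs
    have h1 := hF s (sumOperators_mem ρ A v)
    have h2 := hN ((Nat.card A : k) • v - s) (by
      rw [LinearMap.mem_ker, map_sub, map_smul, sumOperators_apply_of_mem (sumOperators_mem ρ A v),
        ← hs, sub_self])
    rw [map_sub, h1, sub_left_inj, map_smul] at h2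
    exact smul_right_injective V hk h2

/-- Commutative normal subgroups in `P` are cyclic, and their nontrivial elements fix no nonzero
vector; but `x` fixes some `v0 ≠ 0`. So it suffices that the normal closure of `x` or `x ^ 2` is
commutative. The square is needed for `p = 2`, because only squares are sure to centralize normal
cyclic subgroups of order `4`. -/
theorem pow_eq_one_of_elementary_normal_subgroups_cyclic [Finite H] [Nontrivial V] {p : ℕ}
    (hp : p.Prime) (hpk : (p : k) ≠ 0) {ρ : Representation k H V} {P : Subgroup H} [hPn : P.Normal]
    (hP : IsPGroup p P) {x : H} (hx : x ∈ P) (hfix : ∀ v, ∃ h, ρ x (ρ h v) = ρ h v)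
    (hel : ∀ A : Subgroup H, A.Normal → A ≤ P → (∀ a ∈ A, ∀ b ∈ A, Commute a b) →
      (∀ a ∈ A, a ^ p = 1) → A ≠ ⊥ → fixedVectors ρ A = ⊥ ∧ ∃ c, A = Subgroup.zpowers c)
    {m : ℕ} (hm : m = 2 ∨ m = 1 ∧ ∀ a ∈ P, ∀ b ∈ P, Commute a b) : x ^ m = 1 := by
  have hpow : ∀ y ∈ P, ∃ k : ℕ, y ^ p ^ k = 1 := by
    intro e he
    obtain ⟨k, hk⟩ := hP ⟨e, he⟩
    exact ⟨k, by simpa [Subtype.ext_iff] using hk⟩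
  have hcyc : ∀ D : Subgroup H, D.Normal → D ≤ P → (∀ a ∈ D, ∀ b ∈ D, Commute a b) →
      ∃ c, D = Subgroup.zpowers c := by
    intro D hD hDP hDc
    refine exists_eq_zpowers_of_forall_prime_order hp (hP.to_le hDP) hDc ?_
    intro a ha b hb hap hbp ha1
    -- The elements of exponent `p` form an elementary abelian normal subgroup, cyclic by `hel`, so
    -- `D` has at most one subgroup of order `p`.
    let Ω : Subgroup H :=
      { carrier := {e | e ∈ D ∧ e ^ p = 1}
        mul_mem' := fun {e f} he hf => ⟨mul_mem he.1 hf.1, by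
          rw [(hDc e he.1 f hf.1).mul_pow, he.2, hf.2, one_mul]⟩
        one_mem' := ⟨one_mem _, one_pow _⟩
        inv_mem' := fun {e} he => ⟨inv_mem he.1, by rw [inv_pow, he.2, inv_one]⟩ }
    have hΩ : Ω.Normal := ⟨fun e he g => ⟨hD.conj_mem e he.1 g, by rw [conj_pow, he.2]; group⟩⟩
    obtain ⟨-, c, hc⟩ := hel Ω hΩ (fun e he => hDP he.1) (fun e he f hf => hDc e he.1 f hf.1)
      (fun e he => he.2) (fun h => ha1 (Subgroup.mem_bot.mp (h ▸ ⟨ha, hap⟩)))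
    have hcΩ : c ∈ Ω := hc ▸ Subgroup.mem_zpowers c
    have haΩ : a ∈ Subgroup.zpowers c := hc ▸ ⟨ha, hap⟩
    have hbΩ : b ∈ Subgroup.zpowers c := hc ▸ ⟨hb, hbp⟩
    exact Subgroup.zpowers_le.mpr (mem_zpowers_of_mem_zpowers_prime hp hcΩ.2 haΩ ha1) hbΩ
  obtain ⟨v0, hv0, hxv0⟩ : ∃ v0 : V, v0 ≠ 0 ∧ ρ x v0 = v0 := by
    obtain ⟨v, hv⟩ := exists_ne (0 : V)
    obtain ⟨h, hh⟩ := hfix v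
    refine ⟨ρ h v, fun h0 => hv ?_, hh⟩
    rw [← Representation.inv_self_apply ρ h v, h0, map_zero]
  have hcommQ : ∀ Q : Subgroup H, Q.Normal → Q ≤ P → (∀ a ∈ Q, ∀ b ∈ Q, Commute a b) →
      ∀ u ∈ Q, ρ u v0 = v0 → u = 1 := by
    intro Q hQ hQP hQc u hu huv
    by_contra hu1
    obtain ⟨d, rfl⟩ := hcyc Q hQ hQP hQc
    obtain ⟨l, hl⟩ := hpow u (hQP hu)
    -- A power of `u` has order `p` and still fixes `v0`. It generates a normal subgroup, being
    -- inside a cyclic normal one, against `hel`.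
    obtain ⟨t, ht1, ht2⟩ := exists_pow_not_mem_and_pow_mem (N := ⊥) (y := u) (by simpa using hu1)
      (p := p) (k := l) (by simpa using hl)
    have hn := zpowers_normal_of_mem hQ (pow_mem hu (p ^ t))
    have hle : Subgroup.zpowers (u ^ p ^ t) ≤ Subgroup.zpowers d :=
      Subgroup.zpowers_le.mpr (pow_mem hu _)
    obtain ⟨h1, -⟩ := hel _ hn (hle.trans hQP) (fun a ha b hb => hQc a (hle ha) b (hle hb)) (by
      intro a ha
      obtain ⟨j, rfl⟩ := Subgroup.mem_zpowers_iff.mp ha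
      rw [← zpow_natCast, ← zpow_mul, mul_comm, zpow_mul, zpow_natCast, Subgroup.mem_bot.mp ht2,
        one_zpow]) (by simpa using ht1)
    have h2 := mem_fixedVectors_zpowers huv
    have h3 : v0 ∈ fixedVectors ρ (Subgroup.zpowers (u ^ p ^ t)) := fun b hb =>
      h2 b (Subgroup.zpowers_le.mpr (Subgroup.npow_mem_zpowers u _) hb)
    rw [h1] at h3
    exact hv0 (by simpa using h3)
  rcases hm with rfl | ⟨rfl, hPc⟩
  swap
  · rw [pow_one]
    exact hcommQ P hPn le_rfl hPc x hx hxv0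
  have hnc : ∀ y : H, ∀ E : Subgroup H, E.Normal → (∀ e ∈ E, Commute y e) →
      ∀ a ∈ Subgroup.normalClosure {y}, ∀ e ∈ E, Commute a e := by
    intro y E hE hy a ha e he
    have h1 : Subgroup.normalClosure {y} ≤ Subgroup.centralizer (E : Set H) :=
      Subgroup.normalClosure_le_normal (by
        rw [Set.singleton_subset_iff]
        exact Subgroup.mem_centralizer_iff.mpr fun e he => (hy e he).symm)
    exact (Subgroup.mem_centralizer_iff.mp (h1 ha) e he).symm
  rcases eq_or_ne p 2 with rfl | hp2
  · have hu : x ^ 2 ∈ Subgroup.normalClosure {x ^ 2} :=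
      Subgroup.subset_normalClosure (Set.mem_singleton _)
    have hQP : Subgroup.normalClosure {x ^ 2} ≤ P :=
      Subgroup.normalClosure_le_normal (by simpa using pow_mem hx 2)
    have huv : ρ (x ^ 2) v0 = v0 := by
      rw [pow_two, map_mul, Module.End.mul_apply, hxv0, hxv0]
    refine hcommQ _ inferInstance hQP ?_ _ hu huv
    by_contra hQ
    obtain ⟨E, hE, hEQ, hEc, m, hMn, hM, hPE, hsq, h4⟩ := exists_minimal_noncommutative hp
      (n := 4) (Or.inr ⟨rfl, rfl⟩) hP hQP hcyc (by
        intro c _ hcn hc4 y hy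
        have h1 : Subgroup.normalClosure {x ^ 2} ≤ Subgroup.centralizer ({c} : Set H) := by
          rw [Subgroup.normalClosure, Subgroup.closure_le]
          intro g hg
          obtain ⟨_, rfl, hg⟩ := Group.mem_conjugatesOfSet_iff.mp hg
          obtain ⟨h, rfl⟩ := isConj_iff.mp hg
          rw [← conj_pow]
          exact Subgroup.mem_centralizer_singleton_iff.mpr (sq_commute_of_pow_four hcn hc4 _).eq
        exact Subgroup.mem_centralizer_singleton_iff.mp (h1 hy)) hQ
    refine hEc fun a ha b hb => hnc (x ^ 2) E hE ?_ a (hEQ ha) b hb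
    intro e he
    have hmE : m ∈ E := ((hM m).mp (Subgroup.mem_zpowers m)).1
    have haM := hPE e he x hx
    set a := x * e * x⁻¹ * e⁻¹ with ha
    have han := zpowers_normal_of_mem hMn haM
    have haE := ((hM a).mp haM).1
    have hae := ((hM a).mp haM).2 e he
    have hxe : x * e * x⁻¹ = a * e := by rw [ha]; group
    -- Conjugating `e` twice by `x` multiplies it by `x * a * x⁻¹ * a`. This is `1` if `x` inverts
    -- `a`; if `x` centralizes `a`, it remains to show `a ^ 2 = 1`.
    suffices h : x * a * x⁻¹ * a = 1 by
      have h1 : x * (x * e * x⁻¹) * x⁻¹ = e := by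
        calc x * (x * e * x⁻¹) * x⁻¹ = x * (a * e) * x⁻¹ := by rw [hxe]
          _ = (x * a * x⁻¹) * (x * e * x⁻¹) := by group
          _ = e := by rw [hxe, ← mul_assoc, h, one_mul]
      show x ^ 2 * e = e * x ^ 2
      nth_rewrite 2 [← h1]
      rw [pow_two]; group
    rcases conj_eq_or_eq_inv_of_pow_four han (h4 a haE) x with h | h
    · rw [h]
      obtain ⟨i, hi⟩ := Subgroup.mem_zpowers_iff.mp haM
      by_cases hi2 : (2 : ℤ) ∣ i
      · obtain ⟨j, rfl⟩ := hi2
        have hm4 : m ^ (4 : ℤ) = 1 := by exact_mod_cast h4 m hmE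
        rw [← hi, ← zpow_add, show 2 * j + 2 * j = 4 * j by ring, zpow_mul, hm4, one_zpow]
      -- An odd power of `m` generates `⟨m⟩`, so `e ^ 2` is a power of `a` and is centralized by
      -- `x`. Squaring `x * e * x⁻¹ = a * e` then gives `a ^ 2 = 1`.
      · have hma : m ∈ Subgroup.zpowers a := by
          rw [← hi]
          exact mem_zpowers_zpow_of_not_dvd hp (k := 2) (h4 m hmE) (by exact_mod_cast hi2)
        obtain ⟨l, hl⟩ := Subgroup.mem_zpowers_iff.mp
          (Subgroup.zpowers_le.mpr hma (hsq e he))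
        have h2 : x * e ^ 2 * x⁻¹ = e ^ 2 := by rw [← hl, ← conj_zpow, h]
        rw [← conj_pow, hxe, (hae.symm).mul_pow, mul_eq_right, pow_two] at h2
        exact h2
    · rw [h, inv_mul_cancel]
  · suffices h : x = 1 by rw [h, one_pow]
    have hxQ : x ∈ Subgroup.normalClosure {x} :=
      Subgroup.subset_normalClosure (Set.mem_singleton _)
    have hQP : Subgroup.normalClosure {x} ≤ P :=
      Subgroup.normalClosure_le_normal (by simpa using hx)
    refine hcommQ _ inferInstance hQP ?_ _ hxQ hxv0
    by_contra hQ
    obtain ⟨E, hE, hEQ, hEc, m, hMn, hM, hPE, -, hexp⟩ := exists_minimal_noncommutative hp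
      (n := p) (Or.inl ⟨rfl, hp2⟩) hP hQP hcyc (by
        intro c _ hcn hcp y hy
        obtain ⟨l, hl⟩ := hpow y (hQP hy)
        exact commute_of_zpowers_normal_of_pow_prime hp hcn hcp hl) hQ
    have hMle : Subgroup.zpowers m ≤ E := fun a ha => ((hM a).mp ha).1
    refine hEc fun a ha b hb => hnc x E hE ?_ a (hEQ ha) b hb
    refine commute_of_fixes_point_in_each_orbit_of_odd hp hp2 hpk ρ hP (hEQ.trans hQP) hEc hMn hM
      hPE hexp ?_ hx hfix
    refine (hel _ hMn (hMle.trans (hEQ.trans hQP)) (fun a ha b hb => ((hM b).mp hb).2 a (hMle ha))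
      (fun a ha => hexp a (hMle ha)) ?_).1
    intro hbot
    -- a nontrivial group `E / Z(E)` with trivial commutators and trivial center
    refine hEc fun a ha b hb => ?_
    have h1 := hPE b hb a (hQP (hEQ ha))
    rw [hbot, Subgroup.mem_bot] at h1
    exact mul_inv_eq_iff_eq_mul.mp (mul_inv_eq_one.mp h1)

end

/-- A representation restricted to a subgroup and an invariant subspace. -/
def restrictRepresentation {k H V : Type*} [Field k] [Group H] [AddCommGroup V] [Module k V]
    (ρ : Representation k H V) (L : Subgroup H) (W : Submodule k V)
    (hW : ∀ h ∈ L, ∀ v ∈ W, ρ h v ∈ W) : Representation k L W where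
  toFun h := (ρ h).restrict (hW h h.2)
  map_one' := by ext; simp
  map_mul' g h := by ext; simp

universe u v

/-- If an element `x` of a normal `p`-subgroup fixes a vector in each orbit of a coprime linear
action, then `x ^ 2` acts trivially, and so does `x` if the normal subgroup is commutative. -/
theorem pow_acts_trivially_of_fixes_point_in_each_orbit {k : Type*} [Field k] {p : ℕ}
    (hp : p.Prime) (hpk : (p : k) ≠ 0) (m d : ℕ) :
    ∀ (H : Type u) [Group H] [Finite H] (V : Type v) [AddCommGroup V] [Module k V]
      [FiniteDimensional k V] (ρ : Representation k H V) (P : Subgroup H) [P.Normal] (x : H),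
      IsPGroup p P → x ∈ P → (m = 2 ∨ m = 1 ∧ ∀ a ∈ P, ∀ b ∈ P, Commute a b) →
      (∀ v, ∃ h, ρ x (ρ h v) = ρ h v) → Module.finrank k V = d → ∀ v, ρ (x ^ m) v = v := by
  induction d using Nat.strong_induction_on with
  | _ d ih =>
  intro H _ _ V _ _ _ ρ P _ x hP hx hm hfix hd
  have : Fact p.Prime := ⟨hp⟩
  rcases subsingleton_or_nontrivial V with hV | hV
  · exact fun v => Subsingleton.elim _ _
  -- the faithful case
  suffices key : ∀ (H : Type u) [Group H] [Finite H] (ρ : Representation k H V) (P : Subgroup H)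
      [P.Normal] (x : H), IsPGroup p P → x ∈ P →
      (m = 2 ∨ m = 1 ∧ ∀ a ∈ P, ∀ b ∈ P, Commute a b) → (∀ v, ∃ h, ρ x (ρ h v) = ρ h v) →
      (∀ h, (∀ v, ρ h v = v) → h = 1) → ∀ v, ρ (x ^ m) v = v by
    let K : Subgroup H := MonoidHom.ker ρ
    have hK : K.Normal := inferInstanceAs (MonoidHom.ker ρ).Normal
    let ρ' : Representation k (H ⧸ K) V := QuotientGroup.lift K ρ fun h hh => hh
    have hρ' : ∀ h : H, ρ' (h : H ⧸ K) = ρ h := fun h => rfl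
    have hPn : (P.map (QuotientGroup.mk' K)).Normal :=
      Subgroup.Normal.map ‹_› _ (QuotientGroup.mk'_surjective K)
    refine key (H ⧸ K) ρ' (P.map (QuotientGroup.mk' K)) (x : H ⧸ K) (hP.map _) ⟨x, hx, rfl⟩ ?_ ?_ ?_
    · refine hm.imp_right fun h => ⟨h.1, ?_⟩
      rintro _ ⟨a, ha, rfl⟩ _ ⟨b, hb, rfl⟩
      exact (h.2 a ha b hb).map _
    · intro v
      obtain ⟨h, hh⟩ := hfix v
      exact ⟨(h : H ⧸ K), hh⟩
    · intro h hh
      obtain ⟨h, rfl⟩ := QuotientGroup.mk_surjective h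
      rw [QuotientGroup.eq_one_iff]
      exact LinearMap.ext hh
  intro H _ _ ρ P _ x hP hx hm hfix hfaith
  by_contra hcon
  have hIH : ∀ (L : Subgroup H) (W : Submodule k V), (∀ h ∈ L, ∀ v ∈ W, ρ h v ∈ W) → x ∈ L →
      W ≠ ⊤ → (∀ w ∈ W, ∃ h ∈ L, ρ x (ρ h w) = ρ h w) → ∀ w ∈ W, ρ (x ^ m) w = w := by
    intro L W hW hxL hWtop hfixW w hw
    have hlt : Module.finrank k W < d := hd ▸ Submodule.finrank_lt hWtop
    have h1 := ih _ hlt L W (restrictRepresentation ρ L W hW) (P.subgroupOf L) ⟨x, hxL⟩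
      hP.comap_subtype hx
      (hm.imp_right fun h => ⟨h.1, fun a ha b hb => Subtype.ext (h.2 a ha b hb)⟩) (by
        intro v
        obtain ⟨h, hh, hv⟩ := hfixW v v.2
        exact ⟨⟨h, hh⟩, Subtype.ext hv⟩) rfl ⟨w, hw⟩
    exact congrArg Subtype.val h1
  have hx1 := pow_eq_one_of_elementary_normal_subgroups_cyclic hp hpk hP hx hfix (m := m) (by
    intro A hAn hAP hAc hAe hAbot
    refine (elementary_normal_subgroup_dichotomy hp hfaith hfix hIH hP.isNilpotent hx hAc hAe hAbot
      ?_).resolve_left hcon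
    obtain ⟨j, hj⟩ := IsPGroup.iff_card.mp (hP.to_le hAP)
    rw [hj, Nat.cast_pow]
    exact pow_ne_zero _ hpk) hm
  exact hcon fun v => by rw [hx1]; simp

/-! ### Monomial representations from cocycles, and their characters. -/

section Monomial

variable {G O : Type*} [Group G] [MulAction G O]

/-- The monomial representation attached to a one-cocycle of a group acting on a set. -/
def monomialRepresentation (c : G → O → ℂˣ)
    (hc : ∀ g h o, c (g * h) o = c g (h • o) * c h o) : Representation ℂ G (O → ℂ) where
  toFun g :=
    { toFun := fun f o => c g (g⁻¹ • o) * f (g⁻¹ • o)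
      map_add' := fun f f' => by ext o; simp [mul_add]
      map_smul' := fun a f => by ext o; simp; ring }
  map_one' := by
    have h1 : ∀ o, c 1 o = 1 := fun o => by simpa using hc 1 1 o
    ext f o
    simp [h1]
  map_mul' g h := by
    ext f o
    simp [hc, mul_smul, mul_assoc]

variable {c : G → O → ℂˣ} {hc : ∀ g h o, c (g * h) o = c g (h • o) * c h o}

theorem monomialRepresentation_apply (g : G) (f : O → ℂ) (o : O) :
    monomialRepresentation c hc g f o = c g (g⁻¹ • o) * f (g⁻¹ • o) :=
  rfl

theorem monomialRepresentation_single [DecidableEq O] (g : G) (o : O) :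
    monomialRepresentation c hc g (Pi.single o 1) = (c g o : ℂ) • Pi.single (g • o) 1 := by
  ext o'
  rw [monomialRepresentation_apply, Pi.smul_apply, smul_eq_mul]
  by_cases h : o' = g • o
  · subst h; simp
  · have h' : g⁻¹ • o' ≠ o := fun h1 => h (by rw [← h1, smul_inv_smul])
    simp [Pi.single_eq_of_ne h, Pi.single_eq_of_ne h']

theorem character_monomialRepresentation [Fintype O] [DecidableEq O] (g : G) :
    (monomialRepresentation c hc).character g = ∑ o, if g • o = o then (c g o : ℂ) else 0 := by
  rw [Representation.character, LinearMap.trace_eq_matrix_trace ℂ (Pi.basisFun ℂ O), Matrix.trace]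
  refine Finset.sum_congr rfl fun o _ => ?_
  rw [Matrix.diag_apply, LinearMap.toMatrix_apply, Pi.basisFun_apply, Pi.basisFun_repr,
    monomialRepresentation_single, Pi.smul_apply, smul_eq_mul]
  by_cases h : g • o = o
  · simp [h]
  · simp [h]

/-- The elements acting trivially on `O` act diagonally with distinct weights at distinct points. A
nonzero vector of minimal support in an invariant subspace is therefore supported at one point, and
transitivity produces all basis vectors. -/
theorem monomialRepresentation_isIrreducible [Finite O] [MulAction.IsPretransitive G O]
    [Nonempty O]
    (hsep : ∀ o o', o ≠ o' → ∃ w : G, (∀ o : O, w • o = o) ∧ c w o ≠ c w o') :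
    (monomialRepresentation c hc).IsIrreducible := by
  classical
  have _ := Fintype.ofFinite O
  set ρ := monomialRepresentation c hc
  have hnt : Nontrivial (Subrepresentation ρ) := by
    refine ⟨⊥, ⊤, fun h => ?_⟩
    have h1 : (⊥ : Submodule ℂ (O → ℂ)) = ⊤ := congrArg Subrepresentation.toSubmodule h
    exact bot_ne_top h1
  refine ⟨fun σ => or_iff_not_imp_left.mpr fun hσ => ?_⟩
  have hne : ∃ f ∈ σ.toSubmodule, f ≠ 0 := by
    refine (Submodule.ne_bot_iff _).mp fun h => hσ ?_
    exact Subrepresentation.toSubmodule_injective h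
  obtain ⟨f, ⟨hfσ, hf0⟩, hmin⟩ := (measure fun f : O → ℂ =>
    (Finset.univ.filter fun o => f o ≠ 0).card).wf.has_min
    {f | f ∈ σ.toSubmodule ∧ f ≠ 0} hne
  obtain ⟨o, ho⟩ := Function.ne_iff.mp hf0
  have hsupp : ∀ o', o' ≠ o → f o' = 0 := by
    intro o' ho'
    by_contra hfo'
    obtain ⟨w, hw, hcw⟩ := hsep o' o ho'
    have hw' : ∀ o : O, w⁻¹ • o = o := fun o => by rw [inv_smul_eq_iff, hw]
    have hval : ∀ j, (ρ w f - (c w o : ℂ) • f) j = ((c w j : ℂ) - c w o) * f j := by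
      intro j
      rw [Pi.sub_apply, monomialRepresentation_apply, hw', Pi.smul_apply, smul_eq_mul, sub_mul]
    -- Subtracting this multiple kills the coordinate at `o` but not the one at `o'`, so the support
    -- shrinks without becoming empty.
    refine hmin (ρ w f - (c w o : ℂ) • f) ⟨?_, ?_⟩ ?_
    · exact sub_mem (σ.apply_mem_toSubmodule w hfσ) (Submodule.smul_mem _ _ hfσ)
    · intro h0
      have h1 := congrFun h0 o'
      rw [hval, Pi.zero_apply, mul_eq_zero, sub_eq_zero] at h1
      rcases h1 with h1 | h1
      · exact hcw (Units.ext h1)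
      · exact hfo' h1
    · refine Finset.card_lt_card ⟨fun j hj => ?_, fun h => ?_⟩
      · rw [Finset.mem_filter, hval] at hj
        exact Finset.mem_filter.mpr ⟨Finset.mem_univ _, right_ne_zero_of_mul hj.2⟩
      · have h1 := h (Finset.mem_filter.mpr ⟨Finset.mem_univ o, ho⟩)
        rw [Finset.mem_filter, hval, sub_self, zero_mul] at h1
        exact h1.2 rfl
  have hsingle : (Pi.single o 1 : O → ℂ) ∈ σ.toSubmodule := by
    have h1 : (Pi.single o 1 : O → ℂ) = (f o)⁻¹ • f := by
      ext j
      by_cases hj : j = o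
      · subst hj; simp [inv_mul_cancel₀ ho]
      · simp [Pi.single_eq_of_ne hj, hsupp j hj]
    rw [h1]
    exact Submodule.smul_mem _ _ hfσ
  have hall : ∀ j, (Pi.single j 1 : O → ℂ) ∈ σ.toSubmodule := by
    intro j
    obtain ⟨g, rfl⟩ := MulAction.exists_smul_eq G o j
    have h1 := σ.apply_mem_toSubmodule g hsingle
    rw [monomialRepresentation_single] at h1
    have h2 := Submodule.smul_mem _ (c g o : ℂ)⁻¹ h1
    rwa [smul_smul, inv_mul_cancel₀ (Units.ne_zero _), one_smul] at h2
  refine Subrepresentation.toSubmodule_injective (eq_top_iff.mpr fun v _ => ?_)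
  rw [← Finset.univ_sum_single v]
  refine sum_mem fun j _ => ?_
  have h1 : (Pi.single j (v j) : O → ℂ) = v j • Pi.single j 1 := by
    ext i; by_cases hi : i = j
    · subst hi; simp
    · simp [Pi.single_eq_of_ne hi]
  rw [h1]
  exact Submodule.smul_mem _ _ (hall j)

theorem sum_smul_eq_card_stabilizer_mul_sum [Fintype G] [Fintype O] [MulAction.IsPretransitive G O]
    (o0 : O) (φ : O → ℂ) :
    ∑ t : G, φ (t • o0) = (Nat.card (MulAction.stabilizer G o0) : ℂ) * ∑ o, φ o := by
  classical
  rw [← Finset.sum_fiberwise (s := Finset.univ) (g := fun t : G => t • o0), Finset.mul_sum]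
  refine Finset.sum_congr rfl fun o _ => ?_
  rw [Finset.sum_congr rfl (g := fun _ => φ o) (fun t ht => by rw [(Finset.mem_filter.mp ht).2]),
    Finset.sum_const, nsmul_eq_mul]
  congr 2
  obtain ⟨s, rfl⟩ := MulAction.exists_smul_eq G o0 o
  rw [Nat.card_eq_fintype_card, Fintype.card_subtype]
  refine Finset.card_bij (fun t _ => s⁻¹ * t) ?_ ?_ ?_
  · intro t ht
    have h1 := (Finset.mem_filter.mp ht).2
    refine Finset.mem_filter.mpr ⟨Finset.mem_univ _, ?_⟩
    rw [MulAction.mem_stabilizer_iff, mul_smul, h1, inv_smul_smul]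
  · intro t _ t' _ h
    exact mul_left_cancel h
  · intro t ht
    refine ⟨s * t, Finset.mem_filter.mpr ⟨Finset.mem_univ _, ?_⟩, by group⟩
    rw [mul_smul, MulAction.mem_stabilizer_iff.mp (Finset.mem_filter.mp ht).2]

/-- The linear character of a point stabilizer given by a one-cocycle. -/
def stabilizerChar (c : G → O → ℂˣ) (hc : ∀ g h o, c (g * h) o = c g (h • o) * c h o) (o0 : O) :
    MulAction.stabilizer G o0 →* ℂˣ where
  toFun t := c t o0
  map_one' := by simpa using hc 1 1 o0
  map_mul' s t := by
    rw [Subgroup.coe_mul, hc, MulAction.mem_stabilizer_iff.mp t.2]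

theorem inducedLinearChar_stabilizerChar [Fintype G] [Fintype O] [DecidableEq O]
    [MulAction.IsPretransitive G O] (o0 : O) (g : G) :
    inducedLinearChar (MulAction.stabilizer G o0) (stabilizerChar c hc o0) g =
      ∑ o, if g • o = o then (c g o : ℂ) else 0 := by
  have hcard : (Nat.card (MulAction.stabilizer G o0) : ℂ) ≠ 0 := by
    exact_mod_cast Nat.card_pos.ne'
  rw [inducedLinearChar, inv_mul_eq_iff_eq_mul₀ hcard, ← sum_smul_eq_card_stabilizer_mul_sum o0]
  refine Finset.sum_congr rfl fun t _ => ?_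
  have hiff : t⁻¹ * g * t ∈ MulAction.stabilizer G o0 ↔ g • t • o0 = t • o0 := by
    rw [MulAction.mem_stabilizer_iff, mul_smul, mul_smul, inv_smul_eq_iff]
  by_cases h : g • t • o0 = t • o0
  · rw [dif_pos (hiff.mpr h), if_pos h]
    show ((c (t⁻¹ * g * t) o0 : ℂˣ) : ℂ) = _
    congr 1
    have h1 : c t⁻¹ (t • o0) * c t o0 = 1 := by
      rw [← hc, inv_mul_cancel]; simpa using hc 1 1 o0
    rw [hc, hc, h, mul_right_comm, h1, one_mul]
  · rw [dif_neg fun h' => h (hiff.mp h'), if_neg h]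

/-- The character at `x` is a sum over the points fixed by `x`, so it vanishes if there are none.
The points are renumbered by `Fin n` because `irrChar` only admits representations on `Fin n → ℂ`.
-/
theorem exists_smul_eq_of_mem_monomialNonvanishing [Fintype G] [Finite O]
    [MulAction.IsPretransitive G O] [Nonempty O] (c : G → O → ℂˣ)
    (hc : ∀ g h o, c (g * h) o = c g (h • o) * c h o)
    (hsep : ∀ o o', o ≠ o' → ∃ w : G, (∀ o : O, w • o = o) ∧ c w o ≠ c w o') {x : G}
    (hx : x ∈ monomialNonvanishing G) : ∃ o : O, x • o = o := by
  classical
  obtain ⟨n, ⟨e⟩⟩ := Finite.exists_equiv_fin O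
  let _ : MulAction G (Fin n) := Equiv.mulAction G e.symm
  have hsmul : ∀ (g : G) (i : Fin n), g • i = e (g • e.symm i) := fun _ _ => rfl
  let c' : G → Fin n → ℂˣ := fun g i => c g (e.symm i)
  have hc' : ∀ g h i, c' (g * h) i = c' g (h • i) * c' h i := by
    intro g h i
    simp only [c', hsmul, Equiv.symm_apply_apply]
    exact hc g h _
  have _ : MulAction.IsPretransitive G (Fin n) := ⟨fun i j => by
    obtain ⟨g, hg⟩ := MulAction.exists_smul_eq G (e.symm i) (e.symm j)
    exact ⟨g, by rw [hsmul, hg, Equiv.apply_symm_apply]⟩⟩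
  obtain ⟨o0⟩ := ‹Nonempty O›
  have _ : Nonempty (Fin n) := ⟨e o0⟩
  have hirr : (monomialRepresentation c' hc').IsIrreducible := by
    refine monomialRepresentation_isIrreducible fun i j hij => ?_
    obtain ⟨w, hw, hcw⟩ := hsep (e.symm i) (e.symm j) (fun h => hij (e.symm.injective h))
    exact ⟨w, fun i => by rw [hsmul, hw, Equiv.apply_symm_apply], hcw⟩
  have hχ : (monomialRepresentation c' hc').character ∈ irrMonomialChar G := by
    refine ⟨⟨n, _, hirr, rfl⟩, MulAction.stabilizer G (e o0), stabilizerChar c' hc' (e o0), ?_⟩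
    ext g
    rw [inducedLinearChar_stabilizerChar, character_monomialRepresentation]
  have h1 := hx _ hχ
  rw [character_monomialRepresentation] at h1
  obtain ⟨i, -, hi⟩ := Finset.exists_ne_zero_of_sum_ne_zero h1
  have h2 : x • i = i := by
    by_contra h
    exact hi (if_neg h)
  exact ⟨e.symm i, e.injective (by rw [Equiv.apply_symm_apply]; exact h2)⟩

end Monomial

/-! ### Inflation of monomial characters. -/

section Inflation

variable {G Q : Type*} [Group G] [Group Q] [Fintype G] [Fintype Q] {π : G →* Q}

theorem isIrreducible_comp_of_surjective {k G Q V : Type*} [Field k] [Group G] [Group Q]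
    [AddCommGroup V] [Module k V] {π : G →* Q} (hπ : Function.Surjective π)
    {ρ : Representation k Q V} (hρ : ρ.IsIrreducible) :
    Representation.IsIrreducible (MonoidHom.comp ρ π : Representation k G V) := by
  let e : Subrepresentation (MonoidHom.comp ρ π : Representation k G V) ≃o Subrepresentation ρ :=
    { toFun := fun σ => ⟨σ.toSubmodule, fun q v hv => by
        obtain ⟨g, rfl⟩ := hπ q
        exact σ.apply_mem_toSubmodule g hv⟩
      invFun := fun σ => ⟨σ.toSubmodule, fun g v hv => σ.apply_mem_toSubmodule (π g) hv⟩
      left_inv := fun σ => rfl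
      right_inv := fun σ => rfl
      map_rel_iff' := Iff.rfl }
  exact (OrderIso.isSimpleOrder_iff e).mpr hρ

theorem inducedLinearChar_comap (hπ : Function.Surjective π) (H : Subgroup Q) (lam : H →* ℂˣ)
    (g : G) : inducedLinearChar (H.comap π) (lam.comp (π.subgroupComap H)) g =
      inducedLinearChar H lam (π g) := by
  classical
  have hfib : ∀ q : Q, (Finset.univ.filter fun t : G => π t = q).card = Nat.card π.ker := by
    intro q
    obtain ⟨s, rfl⟩ := hπ q
    rw [Nat.card_eq_fintype_card, Fintype.card_subtype]
    refine Finset.card_bij (fun t _ => s⁻¹ * t) ?_ ?_ ?_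
    · intro t ht
      have h1 := (Finset.mem_filter.mp ht).2
      exact Finset.mem_filter.mpr ⟨Finset.mem_univ _, by
        rw [MonoidHom.mem_ker, map_mul, h1, map_inv, inv_mul_cancel]⟩
    · intro t _ t' _ h
      exact mul_left_cancel h
    · intro t ht
      have h1 : π t = 1 := (Finset.mem_filter.mp ht).2
      exact ⟨s * t, Finset.mem_filter.mpr ⟨Finset.mem_univ _, by rw [map_mul, h1, mul_one]⟩,
        by group⟩
  have hcard : Nat.card (H.comap π) = Nat.card π.ker * Nat.card H := by
    have h1 := Subgroup.card_mul_index (H.comap π)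
    have h2 := Subgroup.card_mul_index H
    have h3 := Subgroup.card_mul_index π.ker
    rw [Subgroup.index_comap_of_surjective _ hπ] at h1
    rw [Subgroup.index_ker, MonoidHom.range_eq_top.mpr hπ, Subgroup.card_top] at h3
    rw [← h3, ← h2, ← mul_assoc] at h1
    exact Nat.eq_of_mul_eq_mul_right (Nat.pos_of_ne_zero Subgroup.index_ne_zero_of_finite) h1
  have hker : (Nat.card π.ker : ℂ) ≠ 0 := by exact_mod_cast Nat.card_pos.ne'
  let F : Q → ℂ := fun s => if h : s⁻¹ * π g * s ∈ H then (lam ⟨s⁻¹ * π g * s, h⟩ : ℂ) else 0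
  have hsum : ∑ t : G, F (π t) = (Nat.card π.ker : ℂ) * ∑ s, F s := by
    rw [← Finset.sum_fiberwise (s := Finset.univ) (g := fun t : G => π t), Finset.mul_sum]
    refine Finset.sum_congr rfl fun s _ => ?_
    rw [Finset.sum_congr rfl (g := fun _ => F s) (fun t ht => by rw [(Finset.mem_filter.mp ht).2]),
      Finset.sum_const, nsmul_eq_mul, hfib]
  have hF : ∀ t : G, (if h : t⁻¹ * g * t ∈ H.comap π then
      (lam.comp (π.subgroupComap H) ⟨t⁻¹ * g * t, h⟩ : ℂ) else 0) = F (π t) := by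
    intro t
    have h1 : π (t⁻¹ * g * t) = (π t)⁻¹ * π g * π t := by simp
    by_cases h : (π t)⁻¹ * π g * π t ∈ H
    · have h' : t⁻¹ * g * t ∈ H.comap π := by rw [Subgroup.mem_comap, h1]; exact h
      simp only [F]
      rw [dif_pos h, dif_pos h']
      show ((lam _ : ℂˣ) : ℂ) = _
      congr 2
      exact Subtype.ext h1
    · have h' : t⁻¹ * g * t ∉ H.comap π := by rw [Subgroup.mem_comap, h1]; exact h
      simp only [F]
      rw [dif_neg h, dif_neg h']
  rw [inducedLinearChar, inducedLinearChar, hcard, Finset.sum_congr rfl fun t _ => hF t, hsum,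
    Nat.cast_mul, mul_inv, ← mul_assoc, mul_right_comm _ _ (Nat.card π.ker : ℂ),
    inv_mul_cancel₀ hker, one_mul]

theorem map_mem_monomialNonvanishing (hπ : Function.Surjective π) {x : G}
    (hx : x ∈ monomialNonvanishing G) : π x ∈ monomialNonvanishing Q := by
  rintro χ ⟨⟨n, ρ, hρ, rfl⟩, H, lam, hlam⟩
  refine hx (fun g => ρ.character (π g)) ⟨⟨n, MonoidHom.comp ρ π,
    isIrreducible_comp_of_surjective hπ hρ, rfl⟩, H.comap π, lam.comp (π.subgroupComap H), ?_⟩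
  ext g
  rw [inducedLinearChar_comap hπ, ← hlam]

end Inflation

/-! ### The Fitting subgroup as the join of the normal `p`-cores. -/

section Fitting

variable {G : Type*} [Group G]

/-- The subgroup generated by all normal `p`-subgroups of `G`. -/
def primeCore (p : ℕ) (G : Type*) [Group G] : Subgroup G :=
  sSup {N : Subgroup G | N.Normal ∧ IsPGroup p N}

instance primeCore_normal (p : ℕ) : (primeCore p G).Normal :=
  Subgroup.sSup_normal _ fun _ h => h.1

theorem isPGroup_primeCore (p : ℕ) : IsPGroup p (primeCore p G) :=
  Sylow.sSup_of_normal _ (fun _ h => h.2) fun _ h => h.1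

theorem le_primeCore {p : ℕ} {N : Subgroup G} (hN : N.Normal) (h : IsPGroup p N) :
    N ≤ primeCore p G :=
  le_sSup ⟨hN, h⟩

theorem le_fittingSubgroup {N : Subgroup G} (hN : N.Normal) (h : Group.IsNilpotent N) :
    N ≤ fittingSubgroup G :=
  le_sSup ⟨hN, h⟩

instance fittingSubgroup_normal : (fittingSubgroup G).Normal :=
  Subgroup.sSup_normal _ fun _ h => h.1

/-- The Sylow subgroups of `N` are characteristic in `N`, hence normal in `G`, so each lies in a
core. The index of the join in `N` is then divisible by no prime. -/
theorem le_iSup_primeCore [Finite G] {N : Subgroup G} (hN : N.Normal) (h : Group.IsNilpotent N) :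
    N ≤ ⨆ p : (Nat.card G).primeFactors, primeCore p G := by
  set S := ⨆ p : (Nat.card G).primeFactors, primeCore p G
  by_contra hle
  have hidx : (S.subgroupOf N).index ≠ 1 := by
    rwa [Ne, Subgroup.index_eq_one, Subgroup.subgroupOf_eq_top]
  obtain ⟨p, hp, hpd⟩ := Nat.exists_prime_and_dvd hidx
  have : Fact p.Prime := ⟨hp⟩
  have hpG : p ∈ (Nat.card G).primeFactors :=
    Nat.mem_primeFactors.mpr ⟨hp, (hpd.trans (Subgroup.index_dvd_card _)).trans
      (Subgroup.card_subgroup_dvd_card N), Nat.card_pos.ne'⟩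
  obtain ⟨P⟩ : Nonempty (Sylow p N) := inferInstance
  have hPn : (P : Subgroup N).Normal := inferInstance
  have hPc : (P : Subgroup N).Characteristic := P.characteristic_of_normal hPn
  have hle' : (P : Subgroup N).map N.subtype ≤ S :=
    (le_primeCore (ConjAct.normal_of_characteristic_of_normal) (P.isPGroup'.map N.subtype)).trans
      (le_iSup (fun p : (Nat.card G).primeFactors => primeCore (p : ℕ) G) ⟨p, hpG⟩)
  refine P.not_dvd_index (hpd.trans (Subgroup.index_dvd_of_le ?_))
  rwa [Subgroup.map_le_iff_le_comap] at hle'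

theorem isNilpotent_iSup_primeCore [Finite G] :
    Group.IsNilpotent (⨆ p : (Nat.card G).primeFactors, primeCore p G : Subgroup G) := by
  have hcomm : Pairwise fun p q : (Nat.card G).primeFactors =>
      ∀ x y : G, x ∈ primeCore p G → y ∈ primeCore q G → Commute x y := by
    intro p q hpq
    have hp : Fact (p : ℕ).Prime := ⟨Nat.prime_of_mem_primeFactors p.2⟩
    have hq : Fact (q : ℕ).Prime := ⟨Nat.prime_of_mem_primeFactors q.2⟩
    exact Subgroup.commute_of_normal_of_disjoint _ _ inferInstance inferInstance
      (IsPGroup.disjoint_of_ne p q (fun h => hpq (Subtype.ext h)) _ _ (isPGroup_primeCore _)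
        (isPGroup_primeCore _))
  have hn : ∀ p : (Nat.card G).primeFactors, Group.IsNilpotent (primeCore p G) := fun p =>
    have hp : Fact (p : ℕ).Prime := ⟨Nat.prime_of_mem_primeFactors p.2⟩
    (isPGroup_primeCore _).isNilpotent
  rw [← Subgroup.noncommPiCoprod_range (hcomm := hcomm)]
  exact Group.nilpotent_of_surjective _ (Subgroup.noncommPiCoprod hcomm).rangeRestrict_surjective

theorem fittingSubgroup_eq_iSup_primeCore [Finite G] :
    fittingSubgroup G = ⨆ p : (Nat.card G).primeFactors, primeCore p G := by
  refine le_antisymm (sSup_le fun N hN => le_iSup_primeCore hN.1 hN.2) (iSup_le fun p => ?_)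
  have hp : Fact (p : ℕ).Prime := ⟨Nat.prime_of_mem_primeFactors p.2⟩
  exact le_fittingSubgroup inferInstance (isPGroup_primeCore _).isNilpotent

theorem isNilpotent_fittingSubgroup [Finite G] : Group.IsNilpotent (fittingSubgroup G) := by
  rw [fittingSubgroup_eq_iSup_primeCore]
  exact isNilpotent_iSup_primeCore

theorem map_mem_fittingSubgroup [Finite G] {Q : Type*} [Group Q] {π : G →* Q}
    (hπ : Function.Surjective π) {x : G} (hx : x ∈ fittingSubgroup G) :
    π x ∈ fittingSubgroup Q := by
  refine le_fittingSubgroup (N := (fittingSubgroup G).map π)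
    (fittingSubgroup_normal.map π hπ) ?_ (Subgroup.mem_map_of_mem π hx)
  have := isNilpotent_fittingSubgroup (G := G)
  exact Group.nilpotent_of_surjective _ (π.subgroupMap_surjective (fittingSubgroup G))

theorem mem_primeCore_of_mem_fittingSubgroup [Finite G] {p : ℕ} (hp : p.Prime) {y : G}
    (hy : y ∈ fittingSubgroup G) {k : ℕ} (hk : y ^ p ^ k = 1) : y ∈ primeCore p G := by
  have : Fact p.Prime := ⟨hp⟩
  have hF := isNilpotent_fittingSubgroup (G := G)
  have hz : IsPGroup p (Subgroup.zpowers (⟨y, hy⟩ : fittingSubgroup G)) := by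
    rintro ⟨a, n, rfl⟩
    refine ⟨k, Subtype.ext (Subtype.ext ?_)⟩
    simp only [SubgroupClass.coe_pow, SubgroupClass.coe_zpow, Subgroup.coe_one]
    rw [← zpow_natCast, ← zpow_mul, mul_comm, zpow_mul, zpow_natCast, hk, one_zpow]
  obtain ⟨P, hP⟩ := hz.exists_le_sylow
  have hPn : (P : Subgroup (fittingSubgroup G)).Normal := inferInstance
  have hPc := P.characteristic_of_normal hPn
  exact le_primeCore (ConjAct.normal_of_characteristic_of_normal)
    (P.isPGroup'.map (fittingSubgroup G).subtype)
    (Subgroup.mem_map_of_mem _ (hP (Subgroup.mem_zpowers _)))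

end Fitting

/-! ### The minimal situation: a self-centralizing complemented normal subgroup. -/

section Reduction

variable {G : Type*} [Group G]

theorem exists_minimal_normal (G : Type*) [Group G] [Finite G] [Nontrivial G] :
    ∃ W : Subgroup G, W.Normal ∧ W ≠ ⊥ ∧ ∀ K : Subgroup G, K.Normal → K ≠ ⊥ → K ≤ W → K = W := by
  obtain ⟨W, hW⟩ := (Set.toFinite {W : Subgroup G | W.Normal ∧ W ≠ ⊥}).exists_minimal
    ⟨⊤, inferInstance, top_ne_bot⟩
  exact ⟨W, hW.prop.1, hW.prop.2, fun K hK hK' hle => le_antisymm hle (hW.le_of_le ⟨hK, hK'⟩ hle)⟩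

theorem commute_and_pow_eq_one_of_minimal_normal [Finite G] [Group.IsSolvable G] {W : Subgroup G}
    [W.Normal] (hW : W ≠ ⊥)
    (hmin : ∀ K : Subgroup G, K.Normal → K ≠ ⊥ → K ≤ W → K = W) :
    (∀ a ∈ W, ∀ b ∈ W, a * b = b * a) ∧ ∃ q : ℕ, q.Prime ∧ ∀ w ∈ W, w ^ q = 1 := by
  have hlt := Group.IsSolvable.commutator_lt_of_ne_bot hW
  have hbot : ⁅W, W⁆ = ⊥ := by
    by_contra h
    exact hlt.ne (hmin _ inferInstance h hlt.le)
  have hc : ∀ a ∈ W, ∀ b ∈ W, a * b = b * a := fun a ha b hb => by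
    rw [Subgroup.commutator_eq_bot_iff_le_centralizer] at hbot
    exact ((Subgroup.mem_centralizer_iff.mp (hbot ha)) b hb).symm
  refine ⟨hc, ?_⟩
  have hcard : Nat.card W ≠ 1 := by rwa [Ne, Subgroup.card_eq_one]
  obtain ⟨q, hq, hqd⟩ := Nat.exists_prime_and_dvd hcard
  have : Fact q.Prime := ⟨hq⟩
  obtain ⟨a, ha⟩ := exists_prime_orderOf_dvd_card' q hqd
  refine ⟨q, hq, ?_⟩
  let K : Subgroup G :=
    { carrier := {w | w ∈ W ∧ w ^ q = 1}
      one_mem' := ⟨one_mem _, one_pow _⟩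
      mul_mem' := fun {x y} hx hy => ⟨mul_mem hx.1 hy.1, by
        rw [(show Commute x y from hc x hx.1 y hy.1).mul_pow, hx.2, hy.2, one_mul]⟩
      inv_mem' := fun {x} hx => ⟨inv_mem hx.1, by rw [inv_pow, hx.2, inv_one]⟩ }
  have hKn : K.Normal := ⟨fun w hw g => ⟨‹W.Normal›.conj_mem w hw.1 g, by
    rw [conj_pow, hw.2, mul_one, mul_inv_cancel]⟩⟩
  have hK : K = W := by
    refine hmin K hKn (fun h => ?_) fun w hw => hw.1
    have haK : (a : G) ∈ K := ⟨a.2, by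
      have := pow_orderOf_eq_one a
      rw [ha] at this
      simpa using congrArg Subtype.val this⟩
    rw [h, Subgroup.mem_bot, OneMemClass.coe_eq_one] at haK
    rw [haK, orderOf_one] at ha
    exact hq.one_lt.ne ha
  intro w hw
  rw [← hK] at hw
  exact hw.2

theorem isNilpotent_of_forall_commute {W : Subgroup G} (h : ∀ a ∈ W, ∀ b ∈ W, a * b = b * a) :
    Group.IsNilpotent W := by
  let : CommGroup W := { mul_comm := fun a b => Subtype.ext (h a a.2 b b.2) }
  infer_instance

/-- With trivial intersection, the common preimage of the two Fitting subgroups embeds in their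
product. It is then a nilpotent normal subgroup containing `x`. -/
theorem eq_bot_of_inf_eq_bot_of_mem_fittingSubgroup [Finite G] {x : G} (hxF : x ∉ fittingSubgroup G)
    {K W : Subgroup G} [K.Normal] [W.Normal]
    (hK : (x : G ⧸ K) ∈ fittingSubgroup (G ⧸ K)) (hW : (x : G ⧸ W) ∈ fittingSubgroup (G ⧸ W)) :
    K ⊓ W ≠ ⊥ := by
  intro h
  let M : Subgroup G := (fittingSubgroup (G ⧸ K)).comap (QuotientGroup.mk' K) ⊓
    (fittingSubgroup (G ⧸ W)).comap (QuotientGroup.mk' W)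
  let f : M →* fittingSubgroup (G ⧸ K) × fittingSubgroup (G ⧸ W) :=
    (((QuotientGroup.mk' K).comp M.subtype).codRestrict _ fun m => m.2.1).prod
      (((QuotientGroup.mk' W).comp M.subtype).codRestrict _ fun m => m.2.2)
  have hf : f.ker = ⊥ := by
    rw [eq_bot_iff]
    rintro ⟨m, hm⟩ hm'
    have h1 := congrArg (fun z => (z.1 : G ⧸ K)) (MonoidHom.mem_ker.mp hm')
    have h2 := congrArg (fun z => (z.2 : G ⧸ W)) (MonoidHom.mem_ker.mp hm')
    have h1' : m ∈ K := (QuotientGroup.eq_one_iff m).mp h1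
    have h2' : m ∈ W := (QuotientGroup.eq_one_iff m).mp h2
    have : m ∈ K ⊓ W := ⟨h1', h2'⟩
    rw [h, Subgroup.mem_bot] at this
    exact Subtype.ext this
  have := isNilpotent_fittingSubgroup (G := G ⧸ K)
  have := isNilpotent_fittingSubgroup (G := G ⧸ W)
  have hM : Group.IsNilpotent M := Subgroup.isNilpotent_of_ker_le_center f (hf ▸ bot_le)
  exact hxF (le_fittingSubgroup (N := M) inferInstance hM ⟨hK, hW⟩)

theorem sup_eq_of_sylow [Finite G] {p : ℕ} [Fact p.Prime] {W T : Subgroup G} [W.Normal]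
    (hWT : W ≤ T) (hT : ∀ t ∈ T, ∃ k : ℕ, t ^ p ^ k ∈ W) (S : Sylow p T) :
    (S : Subgroup T).map T.subtype ⊔ W = T := by
  have hp : IsPGroup p (T ⧸ W.subgroupOf T) := by
    rintro ⟨t⟩
    obtain ⟨k, hk⟩ := hT t t.2
    exact ⟨k, (QuotientGroup.eq_one_iff (t ^ p ^ k)).mpr (by simpa [Subgroup.mem_subgroupOf] using hk)⟩
  obtain ⟨n, hn⟩ := IsPGroup.iff_card.mp hp
  have htop : (S : Subgroup T) ⊔ W.subgroupOf T = ⊤ := by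
    rw [← Subgroup.index_eq_one]
    have h1 : ((S : Subgroup T) ⊔ W.subgroupOf T).index ∣ (S : Subgroup T).index :=
      Subgroup.index_dvd_of_le le_sup_left
    have h2 : ((S : Subgroup T) ⊔ W.subgroupOf T).index ∣ p ^ n :=
      hn ▸ Subgroup.index_dvd_of_le le_sup_right
    have hcop : Nat.Coprime (S : Subgroup T).index (p ^ n) :=
      (((Fact.out : p.Prime).coprime_iff_not_dvd.mpr S.not_dvd_index).symm).pow_right n
    exact Nat.eq_one_of_dvd_coprimes hcop h1 h2
  have := congrArg (Subgroup.map T.subtype) htop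
  rwa [Subgroup.map_sup, Subgroup.subgroupOf_map_subtype, inf_of_le_left hWT,
    ← MonoidHom.range_eq_map, Subgroup.range_subtype] at this

theorem normal_of_sup_eq_top_of_conj_mem {U W K : Subgroup G} [W.Normal] (h : U ⊔ W = ⊤)
    (hU : ∀ u ∈ U, ∀ k ∈ K, u * k * u⁻¹ ∈ K) (hW : ∀ w ∈ W, ∀ k ∈ K, w * k * w⁻¹ ∈ K) :
    K.Normal := by
  refine ⟨fun k hk g => ?_⟩
  obtain ⟨u, hu, w, hw, rfl⟩ := Subgroup.mem_sup_of_normal_right.mp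
    (show g ∈ U ⊔ W from h ▸ Subgroup.mem_top g)
  have := hU u hu _ (hW w hw k hk)
  simpa [mul_assoc] using this

/-- `κ` is the projection of `G = WU` onto `W` along `U`. Composing a character of `W` with `κ` is
what extends it to its stabilizer. -/
theorem exists_crossed_hom_of_complement {U W : Subgroup G} [W.Normal] (h : U ⊔ W = ⊤)
    (hUW : U ⊓ W = ⊥) (hc : ∀ a ∈ W, ∀ b ∈ W, a * b = b * a) :
    ∃ κ : G → G, (∀ g, κ g ∈ W) ∧ (∀ g h, κ (g * h) = κ g * (g * κ h * g⁻¹)) ∧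
      ∀ w ∈ W, κ w = w := by
  have hex : ∀ g : G, ∃ w ∈ W, w⁻¹ * g ∈ U := fun g => by
    obtain ⟨w, hw, u, hu, rfl⟩ := Subgroup.mem_sup_of_normal_left.mp
      (show g ∈ W ⊔ U from sup_comm U W ▸ h ▸ Subgroup.mem_top g)
    exact ⟨w, hw, by simpa using hu⟩
  have huniq : ∀ g w w' : G, w ∈ W → w' ∈ W → w⁻¹ * g ∈ U → w'⁻¹ * g ∈ U → w = w' := by
    intro g w w' hw hw' h1 h2
    have h3 : w⁻¹ * w' ∈ U ⊓ W := ⟨by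
      have := mul_mem h1 (inv_mem h2)
      simpa [mul_assoc] using this, W.mul_mem (W.inv_mem hw) hw'⟩
    rw [hUW, Subgroup.mem_bot] at h3
    exact inv_mul_eq_one.mp h3
  choose κ hκ hκU using hex
  refine ⟨κ, hκ, fun g h => ?_, fun w hw => ?_⟩
  · have hconj : g * κ h * g⁻¹ ∈ W := ‹W.Normal›.conj_mem _ (hκ h) g
    refine huniq (g * h) _ _ (hκ _) (mul_mem (hκ g) hconj) (hκU _) ?_
    have := mul_mem (hκU g) (hκU h)
    rw [hc _ (hκ g) _ hconj]
    simpa [mul_assoc] using this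
  · exact huniq w _ _ (hκ w) hw (hκU w) (by simp)

/-- A solvable group all of whose proper quotients carry the image of `x` into their Fitting
subgroup, although `x` is not in the Fitting subgroup, is a split extension of a self-centralizing
elementary abelian subgroup. The splitting is recorded by a crossed homomorphism. -/
theorem exists_self_centralizing_split_normal [Finite G] [Group.IsSolvable G] {x : G}
    (hxF : x ∉ fittingSubgroup G)
    (hred : ∀ (K : Subgroup G) [K.Normal], K ≠ ⊥ → (x : G ⧸ K) ∈ fittingSubgroup (G ⧸ K)) :
    ∃ (W : Subgroup G) (_ : W.Normal) (_ : W ≠ ⊥) (q : ℕ), q.Prime ∧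
      (∀ a ∈ W, ∀ b ∈ W, a * b = b * a) ∧ (∀ w ∈ W, w ^ q = 1) ∧ Subgroup.centralizer (W : Set G) ≤ W ∧ fittingSubgroup G ≤ W ∧
      (∀ N : Subgroup (G ⧸ W), N.Normal → IsPGroup q N → N = ⊥) ∧
      ∃ κ : G → G, (∀ g, κ g ∈ W) ∧ (∀ g h, κ (g * h) = κ g * (g * κ h * g⁻¹)) ∧
        ∀ w ∈ W, κ w = w := by
  have : Nontrivial G := by
    refine ⟨x, 1, fun h => hxF ?_⟩
    rw [h]
    exact one_mem _
  obtain ⟨W, hWn, hWbot, hmin⟩ := exists_minimal_normal G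
  obtain ⟨hc, q, hq, hWq⟩ := commute_and_pow_eq_one_of_minimal_normal hWbot hmin
  have hWF : W ≤ fittingSubgroup G := le_fittingSubgroup hWn (isNilpotent_of_forall_commute hc)
  have hall : ∀ N : Subgroup G, N.Normal → N ≠ ⊥ → W ≤ N := by
    intro N hN hNbot
    have h1 := eq_bot_of_inf_eq_bot_of_mem_fittingSubgroup hxF (hred N hNbot) (hred W hWbot)
    exact inf_eq_right.mp (hmin (N ⊓ W) inferInstance h1 inf_le_right)
  -- If the commutator of `N` and `W` were nontrivial it would contain `W`, which nilpotency of `N ≥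
  -- W` forbids.
  have hcen : ∀ N : Subgroup G, N.Normal → Group.IsNilpotent N →
      N ≤ Subgroup.centralizer (W : Set G) := by
    intro N hN hNil
    rw [← Subgroup.commutator_eq_bot_iff_le_centralizer]
    by_contra hne
    have h1 := hall _ inferInstance hne
    have hNbot : N ≠ ⊥ := by
      rintro rfl
      simp at hne
    exact hWbot (eq_bot_of_le_commutator hNil (hall N hN hNbot) (Subgroup.commutator_comm N W ▸ h1))
  -- Otherwise the preimage of the Fitting subgroup of `G ⧸ W` would lie in that of `G`, and with it
  -- `x`.
  obtain ⟨p, hp, hT⟩ : ∃ p : ℕ, p.Prime ∧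
      ¬ (primeCore p (G ⧸ W)).comap (QuotientGroup.mk' W) ≤ fittingSubgroup G := by
    by_contra! hcon
    have hx := hred W hWbot
    rw [fittingSubgroup_eq_iSup_primeCore] at hx
    have hle : (⨆ p : (Nat.card (G ⧸ W)).primeFactors, primeCore p (G ⧸ W)) ≤
        (fittingSubgroup G).map (QuotientGroup.mk' W) := iSup_le fun p => by
      rw [← Subgroup.map_comap_eq_self_of_surjective (QuotientGroup.mk'_surjective W)
        (primeCore p (G ⧸ W))]
      exact Subgroup.map_mono (hcon p (Nat.prime_of_mem_primeFactors p.2))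
    obtain ⟨f, hf, hfx⟩ := hle hx
    have : f⁻¹ * x ∈ W := QuotientGroup.eq.mp hfx
    apply hxF
    simpa using mul_mem hf (hWF this)
  have : Fact p.Prime := ⟨hp⟩
  set T := (primeCore p (G ⧸ W)).comap (QuotientGroup.mk' W) with hTdef
  have hWT : W ≤ T := fun w hw => by
    have : (w : G ⧸ W) = 1 := (QuotientGroup.eq_one_iff w).mpr hw
    simp [hTdef, Subgroup.mem_comap, this, one_mem]
  have hTW : ∀ t ∈ T, ∃ k : ℕ, t ^ p ^ k ∈ W := by
    intro t ht
    obtain ⟨k, hk⟩ := isPGroup_primeCore p ⟨(t : G ⧸ W), ht⟩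
    exact ⟨k, (QuotientGroup.eq_one_iff _).mp (congrArg Subtype.val hk)⟩
  obtain ⟨S⟩ : Nonempty (Sylow p T) := inferInstance
  have hST := sup_eq_of_sylow hWT hTW S
  have hFr := Sylow.normalizer_sup_eq_top S
  set S' := (S : Subgroup T).map T.subtype with hS'
  set U := Subgroup.normalizer (S' : Set G) with hU
  have hUW : U ⊔ W = ⊤ := by
    rw [eq_top_iff, ← hFr, ← hST]
    refine sup_le le_sup_left (sup_le (Subgroup.le_normalizer.trans le_sup_left) le_sup_right)
  have hUtop : U ≠ ⊤ := by
    intro h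
    have hn : S'.Normal := Subgroup.normalizer_eq_top_iff.mp h
    have hpS : IsPGroup p S' := S.isPGroup'.map T.subtype
    apply hT
    rw [← hST]
    exact sup_le (le_fittingSubgroup hn hpS.isNilpotent) hWF
  have hnotle : ¬ W ≤ U := fun h => hUtop (by rw [← hUW, sup_eq_left.mpr h])
  -- The intersection is normalized by `U` and, `W` being commutative, by `W`. If nontrivial it
  -- would contain `W`, and `U` would be all of `G`; the same argument serves for the centralizer of
  -- `W`.
  have hinf : U ⊓ W = ⊥ := by
    by_contra hne
    refine hnotle ((hall _ ?_ hne).trans inf_le_left)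
    refine normal_of_sup_eq_top_of_conj_mem hUW
      (fun u hu k hk => ⟨U.mul_mem (U.mul_mem hu hk.1) (U.inv_mem hu), hWn.conj_mem k hk.2 u⟩)
      fun w hw k hk => ?_
    rwa [hc w hw k hk.2, mul_inv_cancel_right]
  have hCU : Subgroup.centralizer (W : Set G) ⊓ U = ⊥ := by
    by_contra hne
    refine hnotle ((hall _ ?_ hne).trans inf_le_right)
    refine normal_of_sup_eq_top_of_conj_mem hUW
      (fun u hu k hk => ⟨(inferInstance : (Subgroup.centralizer (W : Set G)).Normal).conj_mem k hk.1 u,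
        U.mul_mem (U.mul_mem hu hk.2) (U.inv_mem hu)⟩) fun w hw k hk => ?_
    rwa [Subgroup.mem_centralizer_iff.mp hk.1 w hw, mul_inv_cancel_right]
  have hCW : Subgroup.centralizer (W : Set G) ≤ W := by
    intro g hg
    obtain ⟨w, hw, u, hu, rfl⟩ := Subgroup.mem_sup_of_normal_left.mp
      (show g ∈ W ⊔ U from sup_comm U W ▸ hUW ▸ Subgroup.mem_top g)
    have hw' : w ∈ Subgroup.centralizer (W : Set G) :=
      Subgroup.mem_centralizer_iff.mpr fun y hy => hc y hy w hw
    have : u ∈ Subgroup.centralizer (W : Set G) ⊓ U :=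
      ⟨by simpa using mul_mem (inv_mem hw') hg, hu⟩
    rw [hCU, Subgroup.mem_bot] at this
    simpa [this] using hw
  have hFW : fittingSubgroup G ≤ W := sSup_le fun N hN => (hcen N hN.1 hN.2).trans hCW
  refine ⟨W, hWn, hWbot, q, hq, hc, hWq, hCW, hFW, fun N hN hNq => ?_,
    exists_crossed_hom_of_complement hUW hinf hc⟩
  have : Fact q.Prime := ⟨hq⟩
  have hker : IsPGroup q (QuotientGroup.mk' W).ker := by
    rw [QuotientGroup.ker_mk']
    exact fun w => ⟨1, Subtype.ext (by simpa using hWq w w.2)⟩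
  have hcom := hNq.comap_of_ker_isPGroup (QuotientGroup.mk' W) hker
  have hle := (le_fittingSubgroup (N := N.comap (QuotientGroup.mk' W)) inferInstance
    hcom.isNilpotent).trans hFW
  rw [← Subgroup.map_comap_eq_self_of_surjective (QuotientGroup.mk'_surjective W) N, eq_bot_iff]
  refine (Subgroup.map_mono hle).trans ?_
  rw [QuotientGroup.map_mk'_self]

end Reduction

/-! ### The conjugation action on the dual of `W`. -/

section Dual

variable {G : Type*} [Group G] {W : Subgroup G} [W.Normal]

/-- The conjugation action of a group on the linear characters of a normal subgroup. -/
noncomputable def dualConj (g : G) : (W →* ℂˣ) →* (W →* ℂˣ) :=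
  MonoidHom.compHom' (MulAut.conjNormal g⁻¹ : MulAut W).toMonoidHom

theorem dualConj_apply (g : G) (μ : W →* ℂˣ) (w : W) :
    dualConj g μ w = μ (MulAut.conjNormal g⁻¹ w) :=
  rfl

theorem dualConj_mul (g h : G) (μ : W →* ℂˣ) :
    dualConj (g * h) μ = dualConj g (dualConj h μ) := by
  ext w
  simp [dualConj_apply]

theorem dualConj_one (μ : W →* ℂˣ) : dualConj 1 μ = μ := by
  ext w
  simp [dualConj_apply]

theorem dualConj_of_mem (hc : ∀ a ∈ W, ∀ b ∈ W, a * b = b * a) {g : G} (hg : g ∈ W)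
    (μ : W →* ℂˣ) : dualConj g μ = μ := by
  ext w
  rw [dualConj_apply]
  congr 2
  ext
  rw [MulAut.conjNormal_apply, inv_inv, ← hc w w.2 g⁻¹ (inv_mem hg), inv_mul_cancel_right]

/-- The conjugation action on linear characters as a group action. -/
@[reducible]
noncomputable def dualConjAction : MulAction G (W →* ℂˣ) where
  smul g μ := dualConj g μ
  one_smul := dualConj_one
  mul_smul := dualConj_mul

/-- On the orbit of `μ`, evaluating `g • o` at `κ g` is a cocycle. On `W`, which acts trivially on
the orbit, it is evaluation of `o` itself, so it separates the points, and the monomial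
representation is irreducible. -/
theorem exists_dualConj_eq_of_mem_monomialNonvanishing [Fintype G]
    (hc : ∀ a ∈ W, ∀ b ∈ W, a * b = b * a) {κ : G → G} (hκ : ∀ g, κ g ∈ W)
    (hκm : ∀ g h, κ (g * h) = κ g * (g * κ h * g⁻¹)) (hκw : ∀ w ∈ W, κ w = w) {x : G}
    (hx : x ∈ monomialNonvanishing G) (μ : W →* ℂˣ) :
    ∃ h : G, dualConj x (dualConj h μ) = dualConj h μ := by
  let := dualConjAction (W := W)
  have hsmul : ∀ (g : G) (ν : W →* ℂˣ), g • ν = dualConj g ν := fun _ _ => rfl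
  let O := MulAction.orbit G μ
  have : Finite O := Set.finite_range _
  have : Nonempty O := ⟨⟨μ, MulAction.mem_orbit_self μ⟩⟩
  have hcocycle : ∀ (g h : G) (o : O), ((g * h) • (o : W →* ℂˣ)) ⟨κ (g * h), hκ _⟩ =
      (g • (h • (o : W →* ℂˣ))) ⟨κ g, hκ g⟩ * (h • (o : W →* ℂˣ)) ⟨κ h, hκ h⟩ := by
    intro g h o
    have h1 : (⟨κ (g * h), hκ _⟩ : W) = ⟨κ g, hκ g⟩ * MulAut.conjNormal g ⟨κ h, hκ h⟩ :=
      Subtype.ext (by simp [hκm])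
    rw [h1, map_mul, mul_smul]
    congr 1
    rw [hsmul g, dualConj_apply]
    simp
  have hsep : ∀ o o' : O, o ≠ o' → ∃ w : G, (∀ o : O, w • o = o) ∧
      (w • (o : W →* ℂˣ)) ⟨κ w, hκ w⟩ ≠ (w • (o' : W →* ℂˣ)) ⟨κ w, hκ w⟩ := by
    intro o o' hne
    have : ∃ w : W, (o : W →* ℂˣ) w ≠ (o' : W →* ℂˣ) w := by
      by_contra! hcon
      exact hne (Subtype.ext (MonoidHom.ext hcon))
    obtain ⟨w, hw⟩ := this
    refine ⟨w, fun o => Subtype.ext (dualConj_of_mem hc w.2 _), ?_⟩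
    have hκw' : (⟨κ w, hκ w⟩ : W) = w := Subtype.ext (hκw w w.2)
    rwa [hsmul, hsmul, dualConj_of_mem hc w.2, dualConj_of_mem hc w.2, hκw']
  obtain ⟨⟨o, h, rfl⟩, ho⟩ := exists_smul_eq_of_mem_monomialNonvanishing (O := O)
    (fun g o => (g • (o : W →* ℂˣ)) ⟨κ g, hκ g⟩) hcocycle hsep hx
  exact ⟨h, congrArg Subtype.val ho⟩

/-- The group of linear characters of `W`, written additively. -/
def AdditiveDual (W : Subgroup G) : Type _ :=
  Additive (W →* ℂˣ)

noncomputable instance : AddCommGroup (AdditiveDual W) :=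
  inferInstanceAs (AddCommGroup (Additive (W →* ℂˣ)))

instance [Finite G] : Finite (AdditiveDual W) :=
  inferInstanceAs (Finite (W →* ℂˣ))

/-- The homomorphism to additive endomorphisms afforded by the conjugation action on linear
characters. -/
noncomputable def dualConjEnd : G →* AddMonoid.End (AdditiveDual W) where
  toFun g :=
    { toFun := fun μ : W →* ℂˣ => dualConj g μ
      map_zero' := map_one (dualConj g)
      map_add' := fun μ ν : W →* ℂˣ => map_mul (dualConj g) μ ν }
  map_one' := AddMonoidHom.ext fun μ => dualConj_one (W := W) μ
  map_mul' g h := AddMonoidHom.ext fun μ => dualConj_mul (W := W) g h μ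

theorem mem_centralizer_of_forall_dualConj_eq [Finite G] (hc : ∀ a ∈ W, ∀ b ∈ W, a * b = b * a)
    {g : G} (hg : ∀ μ : W →* ℂˣ, dualConj g μ = μ) : g ∈ Subgroup.centralizer (W : Set G) := by
  let : CommGroup W := { mul_comm := fun a b => Subtype.ext (hc a a.2 b b.2) }
  rw [Subgroup.mem_centralizer_iff]
  intro w hw
  by_contra hne
  have hne' : (MulAut.conjNormal g⁻¹ ⟨w, hw⟩ : W) * (⟨w, hw⟩ : W)⁻¹ ≠ 1 := by
    intro h
    rw [mul_inv_eq_one] at h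
    have := congrArg Subtype.val h
    rw [MulAut.conjNormal_apply, inv_inv] at this
    apply hne
    change g⁻¹ * w * g = w at this
    rw [← mul_right_inj g⁻¹]
    rw [← mul_assoc, this]
    simp
  obtain ⟨φ, hφ⟩ := CommGroup.exists_apply_ne_one_of_hasEnoughRootsOfUnity W ℂ hne'
  apply hφ
  have hinv : φ (⟨w, hw⟩ : W)⁻¹ = (φ ⟨w, hw⟩)⁻¹ := map_inv φ _
  rw [MonoidHom.map_mul, hinv, mul_inv_eq_one]
  exact DFunLike.congr_fun (hg φ) ⟨w, hw⟩

end Dual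

/-! ### Combining the module theorem with the reduction. -/

/-- The representation over `ZMod q` afforded by an action by endomorphisms on a commutative group of
exponent `q`. -/
def zmodRepresentation {A M : Type*} [Group A] [AddCommGroup M] (q : ℕ) [Module (ZMod q) M]
    (f : A →* AddMonoid.End M) : Representation (ZMod q) A M where
  toFun a := AddMonoidHom.toZModLinearMap q (f a)
  map_one' := LinearMap.ext fun m => DFunLike.congr_fun (map_one f) m
  map_mul' a b := LinearMap.ext fun m => DFunLike.congr_fun (map_mul f a b) m

theorem pow_acts_trivially_of_exponent_prime {A : Type*} {M : Type*} [Group A] [Finite A]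
    [AddCommGroup M] [Finite M] {p q : ℕ} (hp : p.Prime) [Fact q.Prime] (hpq : p ≠ q)
    [Module (ZMod q) M] (f : A →* AddMonoid.End M) {P : Subgroup A} [P.Normal]
    (hP : IsPGroup p P) {y : A} (hy : y ∈ P) {m : ℕ}
    (hm : m = 2 ∨ m = 1 ∧ ∀ a ∈ P, ∀ b ∈ P, Commute a b)
    (hfix : ∀ v, ∃ h, f y (f h v) = f h v) (v : M) : f (y ^ m) v = v := by
  have hq : q.Prime := Fact.out
  have hpk : (p : ZMod q) ≠ 0 := by
    rw [Ne, ZMod.natCast_eq_zero_iff]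
    exact fun h => hpq ((Nat.prime_dvd_prime_iff_eq hq hp).mp h).symm
  have : FiniteDimensional (ZMod q) M := Module.Finite.of_finite
  exact pow_acts_trivially_of_fixes_point_in_each_orbit hp hpk m _ A M (zmodRepresentation q f) P y
    hP hy hm hfix rfl v

/-- For `p = q` the group `P` is trivial. Otherwise the module theorem applies to the dual of `W`,
on which `G ⧸ W` acts faithfully because `W` contains its centralizer. The exponent `j` serves to
pass to `p`-parts. -/
theorem pow_eq_one_of_mem_normal_pgroup_quotient {G : Type*} [Group G] [Fintype G] {W : Subgroup G}
    [W.Normal] {q : ℕ} (hq : q.Prime) (hc : ∀ a ∈ W, ∀ b ∈ W, a * b = b * a)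
    (hWq : ∀ w ∈ W, w ^ q = 1) (hCW : Subgroup.centralizer (W : Set G) ≤ W)
    (hcore : ∀ N : Subgroup (G ⧸ W), N.Normal → IsPGroup q N → N = ⊥)
    {κ : G → G} (hκ : ∀ g, κ g ∈ W)
    (hκm : ∀ g h, κ (g * h) = κ g * (g * κ h * g⁻¹)) (hκw : ∀ w ∈ W, κ w = w) {x : G}
    (hx : x ∈ monomialNonvanishing G) {p : ℕ} (hp : p.Prime) {P : Subgroup (G ⧸ W)} [P.Normal]
    (hP : IsPGroup p P) {j m : ℕ} (hxP : (x : G ⧸ W) ^ j ∈ P)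
    (hm : m = 2 ∨ m = 1 ∧ ∀ a ∈ P, ∀ b ∈ P, Commute a b) :
    ((x : G ⧸ W) ^ j) ^ m = 1 := by
  by_cases hpq : p = q
  · subst hpq
    rw [hcore P inferInstance hP, Subgroup.mem_bot] at hxP
    rw [hxP, one_pow]
  have hM : ∀ μ : AdditiveDual W, q • μ = 0 := fun (μ : W →* ℂˣ) => by
    change μ ^ q = 1
    refine MonoidHom.ext fun w => ?_
    rw [MonoidHom.pow_apply, ← map_pow, show w ^ q = 1 from Subtype.ext (hWq w w.2), map_one,
      MonoidHom.one_apply]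
  let f : G ⧸ W →* AddMonoid.End (AdditiveDual W) :=
    QuotientGroup.lift W (dualConjEnd (W := W)) fun w hw =>
      AddMonoidHom.ext fun μ => dualConj_of_mem (W := W) hc hw μ
  have hfix : ∀ v, ∃ h, f ((x : G ⧸ W) ^ j) (f h v) = f h v := by
    intro v
    obtain ⟨h, hh⟩ := exists_dualConj_eq_of_mem_monomialNonvanishing hc hκ hκm hκw hx v
    refine ⟨h, ?_⟩
    have h1 : f (x : G ⧸ W) (f h v) = f h v := hh
    generalize f (h : G ⧸ W) v = v' at h1 ⊢
    clear hxP
    induction j with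
    | zero => rw [pow_zero, map_one, AddMonoid.End.coe_one, id_eq]
    | succ j ih => rw [pow_succ, map_mul, AddMonoid.End.coe_mul, Function.comp_apply, h1, ih]
  have : Fact q.Prime := ⟨hq⟩
  let := AddCommGroup.zmodModule hM
  have htriv := pow_acts_trivially_of_exponent_prime hp hpq f hP hxP hm hfix
  rw [← QuotientGroup.mk_pow, ← QuotientGroup.mk_pow] at htriv ⊢
  rw [QuotientGroup.eq_one_iff]
  exact hCW (mem_centralizer_of_forall_dualConj_eq hc fun μ => htriv μ)

/-- For a prime `p`, let `n` be the part of the order of `u` prime to `p`; then `u ^ n` lies in the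
`p`-core, and `h` bounds its order. Applying this to a prime divisor of the order of `u ^ 2` gives
`u ^ 2 = 1`. If `u` were in a commutative normal `A`, the intersection of `A` with the core would
allow `m = 1` and give `u = 1`. -/
theorem orderOf_eq_two_and_not_mem_of_pow_eq_one {H : Type*} [Group H] [Finite H] {u : H}
    (hu : u ∈ fittingSubgroup H) (hu1 : u ≠ 1)
    (h : ∀ p : ℕ, p.Prime → ∀ P : Subgroup H, P.Normal → IsPGroup p P → ∀ j m : ℕ, u ^ j ∈ P →
      (m = 2 ∨ m = 1 ∧ ∀ a ∈ P, ∀ b ∈ P, Commute a b) → (u ^ j) ^ m = 1) :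
    orderOf u = 2 ∧ ∀ A : Subgroup H, A.Normal → IsMulCommutative A → u ∉ A := by
  constructor
  · refine orderOf_eq_prime ?_ hu1
    by_contra hne
    obtain ⟨p, hp, hpd⟩ := Nat.exists_prime_and_dvd (fun h => hne (orderOf_eq_one_iff.mp h))
    obtain ⟨a, n, hn, hun⟩ := Nat.exists_eq_pow_mul_and_not_dvd (orderOf_pos u).ne' p hp.ne_one
    have hy : (u ^ n) ^ p ^ a = 1 := by
      rw [← pow_mul, mul_comm, ← hun, pow_orderOf_eq_one]
    have h1 := h p hp _ inferInstance (isPGroup_primeCore p) n 2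
      (mem_primeCore_of_mem_fittingSubgroup hp (pow_mem hu n) hy) (Or.inl rfl)
    rw [← pow_mul, mul_comm, pow_mul] at h1
    exact hn (hpd.trans (orderOf_dvd_of_pow_eq_one h1))
  · intro A hA hcomm huA
    obtain ⟨p, hp, hpd⟩ := Nat.exists_prime_and_dvd (fun h => hu1 (orderOf_eq_one_iff.mp h))
    obtain ⟨a, n, hn, hun⟩ := Nat.exists_eq_pow_mul_and_not_dvd (orderOf_pos u).ne' p hp.ne_one
    have hy : (u ^ n) ^ p ^ a = 1 := by
      rw [← pow_mul, mul_comm, ← hun, pow_orderOf_eq_one]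
    have h1 := h p hp (primeCore p H ⊓ A) inferInstance ((isPGroup_primeCore p).to_le inf_le_left)
      n 1 ⟨mem_primeCore_of_mem_fittingSubgroup hp (pow_mem hu n) hy, pow_mem huA n⟩
      (Or.inr ⟨rfl, fun a ha b hb => congrArg Subtype.val
        (mul_comm' (⟨a, ha.2⟩ : A) ⟨b, hb.2⟩)⟩)
    rw [pow_one] at h1
    exact hn (hpd.trans (orderOf_dvd_of_pow_eq_one h1))

theorem mainTheorem10 {G : Type*} [Group G] [Fintype G] [Group.IsSolvable G] (x : G)
    (hx : x ∈ monomialNonvanishing G) (hxF : x ∉ fittingSubgroup G) :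
    ∃ (N : Subgroup G) (_ : N.Normal), fittingSubgroup G ≤ N ∧
      (x : G ⧸ N) ∈ fittingSubgroup (G ⧸ N) ∧
      orderOf (x : G ⧸ N) = 2 ∧
      ∀ A : Subgroup (G ⧸ N), A.Normal → IsMulCommutative A → (x : G ⧸ N) ∉ A := by
  obtain ⟨L, hL⟩ := (Set.toFinite {L : Subgroup G | ∃ _ : L.Normal,
    (x : G ⧸ L) ∉ fittingSubgroup (G ⧸ L)}).exists_maximal ⟨⊥, inferInstance, fun h => hxF (by
      have := map_mem_fittingSubgroup (π := (QuotientGroup.quotientBot (G := G)).toMonoidHom)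
        (QuotientGroup.quotientBot (G := G)).surjective h
      exact this)⟩
  obtain ⟨hLn, hxL⟩ := hL.prop
  let : Fintype (G ⧸ L) := Fintype.ofFinite _
  have hxn : (x : G ⧸ L) ∈ monomialNonvanishing (G ⧸ L) :=
    map_mem_monomialNonvanishing (QuotientGroup.mk'_surjective L) hx
  have hred : ∀ (K : Subgroup (G ⧸ L)) [K.Normal], K ≠ ⊥ →
      ((x : G ⧸ L) : (G ⧸ L) ⧸ K) ∈ fittingSubgroup ((G ⧸ L) ⧸ K) := by
    intro K hK hKbot
    by_contra hcon
    -- The preimage of `K` in `G` would be a strictly larger normal subgroup for which `x` stays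
    -- outside the Fitting subgroup, against the maximality of `L`.
    let M := K.comap (QuotientGroup.mk' L)
    have hLM : L ≤ M := QuotientGroup.le_comap_mk' L K
    have hM : (x : G ⧸ M) ∉ fittingSubgroup (G ⧸ M) := fun h => hcon
      (map_mem_fittingSubgroup (π := QuotientGroup.lift M
        ((QuotientGroup.mk' K).comp (QuotientGroup.mk' L))
        fun m hm => (QuotientGroup.eq_one_iff _).mpr hm)
        (QuotientGroup.lift_surjective_of_surjective M
          ((QuotientGroup.mk' K).comp (QuotientGroup.mk' L))
          ((QuotientGroup.mk'_surjective K).comp (QuotientGroup.mk'_surjective L)) _) h)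
    have hML : M ≤ L := hL.le_of_ge ⟨inferInstance, hM⟩ hLM
    apply hKbot
    rw [← Subgroup.map_comap_eq_self_of_surjective (QuotientGroup.mk'_surjective L) K, eq_bot_iff]
    exact (Subgroup.map_mono hML).trans (by rw [QuotientGroup.map_mk'_self])
  obtain ⟨W, hWn, hWbot, q, hq, hc, hWq, hCW, hFW, hcore, κ, hκ, hκm, hκw⟩ :=
    exists_self_centralizing_split_normal hxL hred
  have hu := hred W hWbot
  obtain ⟨hord, hab⟩ := orderOf_eq_two_and_not_mem_of_pow_eq_one hu (fun h => hxL
    (le_fittingSubgroup hWn (isNilpotent_of_forall_commute hc) ((QuotientGroup.eq_one_iff _).mp h)))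
    fun p hp P hPn hP j m hj hm =>
      pow_eq_one_of_mem_normal_pgroup_quotient hq hc hWq hCW hcore hκ hκm hκw hxn hp hP hj hm
  let φ : G →* (G ⧸ L) ⧸ W := (QuotientGroup.mk' W).comp (QuotientGroup.mk' L)
  have hφ : Function.Surjective φ :=
    (QuotientGroup.mk'_surjective W).comp (QuotientGroup.mk'_surjective L)
  let e := QuotientGroup.quotientKerEquivOfSurjective φ hφ
  have hex : e (x : G ⧸ φ.ker) = ((x : G ⧸ L) : (G ⧸ L) ⧸ W) := rfl
  refine ⟨φ.ker, inferInstance, fun f hf => ?_, ?_, ?_, fun A hA hAc hxA => ?_⟩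
  · exact (QuotientGroup.eq_one_iff _).mpr
      (hFW (map_mem_fittingSubgroup (QuotientGroup.mk'_surjective L) hf))
  · have := map_mem_fittingSubgroup (π := e.symm.toMonoidHom) e.symm.surjective hu
    rw [← hex] at this
    simpa using this
  · rw [← hord, ← hex, MulEquiv.orderOf_eq]
  · refine hab (A.map e.toMonoidHom) (hA.map _ e.surjective) ?_ ⟨_, hxA, hex⟩
    infer_instance
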